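/- Theorem 1.3. Let $p$ be a prime, let $G$ be a finite group, and let $P$ be a Sylow $p$-subgroup of $G$ with $|P|\ge p^{2}$. A subgroup $H$ of $G$ is said to satisfy the partial $\Pi$-property in $G$ if there is a chief series $1=G_0<G_1<\cdots<G_n=G$ of $G$ such that for every $i=1,\dots,n$ each prime dividing the index $$\bigl|\,G/G_{i-1} : N_{G/G_{i-1}}\bigl(HG_{i-1}/G_{i-1}\cap G_i/G_{i-1}\bigr)\bigr|$$ divides the order of $HG_{i-1}/G_{i-1}\cap G_i/G_{i-1}$. If every subgroup of $P$ of order $p^{2}$ satisfies the partial $\Pi$-property in $G$, then $G$ is $p$-soluble (that is, every chief factor of $G$ is a $p$-group or has order prime to $p$) and the $p$-length of $G$ is at most $1$. Here the $p$-length of $G$ is the least $l\ge 0$ with $N_l=G$ in the upper $p$-series $1=P_0\le N_0\le P_1\le N_1\le\cdots$ of $G$, defined by $N_k/P_k=O_{p'}(G/P_k)$ and $P_{k+1}/N_k=O_p(G/N_k)$, where $O_p(X)$ and $O_{p'}(X)$ denote the largest normal $p$-subgroup and the largest normal subgroup of order prime to $p$ of a finite group $X$. -/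

import Mathlib

/-- `n` is a `π`-number: all prime divisors of `n` belong to the set of primes `π`. -/
def IsPiNumber (π : Set ℕ) (n : ℕ) : Prop :=
  ∀ q : ℕ, q.Prime → q ∣ n → q ∈ π

/-- `π(X)`: the set of primes dividing the order of the finite group `X`. -/
def primesOfCard (X : Type*) : Set ℕ :=
  {q : ℕ | q.Prime ∧ q ∣ Nat.card X}

/-- `L / K` is a chief factor of `G`: `K < L` are normal subgroups of `G`, and no normal subgroup
of `G` lies strictly between them. -/
structure IsChiefFactor {G : Type*} [Group G] (K L : Subgroup G) : Prop where
  normal_bot : K.Normal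
  normal_top : L.Normal
  lt : K < L
  eq_or_eq : ∀ M : Subgroup G, M.Normal → K ≤ M → M ≤ L → M = K ∨ M = L

/-- A chief series `1 = G₀ < G₁ < ⋯ < Gₙ = G` of `G`. -/
structure ChiefSeries (G : Type*) [Group G] where
  length : ℕ
  term : Fin (length + 1) → Subgroup G
  normal_term : ∀ i, (term i).Normal
  term_zero : term 0 = ⊥
  term_last : term (Fin.last length) = ⊤
  isChiefFactor : ∀ i : Fin length, IsChiefFactor (term i.castSucc) (term i.succ)

/-- For `K` normal in `G`, the image `L K / K` of a subgroup `L` in `G / K`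
(which is `L / K` when `K ≤ L`). -/
def Subgroup.imageMod {G : Type*} [Group G] (L K : Subgroup G) [K.Normal] : Subgroup (G ⧸ K) :=
  L.map (QuotientGroup.mk' K)

/-- The condition imposed by the partial `Π`-property at the factor `L / K`: the index
`|G/K : N_{G/K}(HK/K ∩ L/K)|` is a `π(HK/K ∩ L/K)`-number. -/
def PiConditionAt {G : Type*} [Group G] (H K L : Subgroup G) [K.Normal] : Prop :=
  IsPiNumber (primesOfCard ↥(H.imageMod K ⊓ L.imageMod K))
    (Subgroup.normalizer
      ((H.imageMod K ⊓ L.imageMod K : Subgroup (G ⧸ K)) : Set (G ⧸ K))).index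

/-- `H` satisfies the partial `Π`-property in `G`: for some chief series of `G`, the index
condition holds at every chief factor of that series. -/
def PartialPiProperty {G : Type*} [Group G] (H : Subgroup G) : Prop :=
  ∃ Γ : ChiefSeries G, ∀ i : Fin Γ.length,
    haveI := Γ.normal_term i.castSucc
    PiConditionAt H (Γ.term i.castSucc) (Γ.term i.succ)

/-- `G` is `p`-soluble: every chief factor of `G` is a `p`-group or a `p'`-group. -/
def IsPSoluble (p : ℕ) (G : Type*) [Group G] : Prop :=
  ∀ (K L : Subgroup G) [K.Normal], IsChiefFactor K L →
    IsPGroup p ↥(L.imageMod K) ∨ (Nat.card ↥(L.imageMod K)).Coprime p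

/-- `O_p(G)`, the subgroup generated by all normal `p`-subgroups of `G` (for finite `G`, the
largest normal `p`-subgroup). -/
def pRadical (p : ℕ) (G : Type*) [Group G] : Subgroup G :=
  sSup {N : Subgroup G | N.Normal ∧ IsPGroup p ↥N}

/-- `O_{p'}(G)`, the subgroup generated by all normal `p'`-subgroups of `G` (for finite `G`, the
largest normal `p'`-subgroup). -/
def pPrimeRadical (p : ℕ) (G : Type*) [Group G] : Subgroup G :=
  sSup {N : Subgroup G | N.Normal ∧ (Nat.card ↥N).Coprime p}

instance pRadical_normal (p : ℕ) (G : Type*) [Group G] : (pRadical p G).Normal :=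
  Subgroup.sSup_normal _ fun _ h => h.1

instance pPrimeRadical_normal (p : ℕ) (G : Type*) [Group G] : (pPrimeRadical p G).Normal :=
  Subgroup.sSup_normal _ fun _ h => h.1

/-- The normal subgroup `M` of `G` with `M / N = O_p(G / N)`. -/
def pRadicalOver (p : ℕ) {G : Type*} [Group G] (N : {N : Subgroup G // N.Normal}) :
    {N : Subgroup G // N.Normal} :=
  haveI := N.2
  ⟨(pRadical p (G ⧸ N.1)).comap (QuotientGroup.mk' N.1), inferInstance⟩

/-- The normal subgroup `M` of `G` with `M / N = O_{p'}(G / N)`. -/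
def pPrimeRadicalOver (p : ℕ) {G : Type*} [Group G] (N : {N : Subgroup G // N.Normal}) :
    {N : Subgroup G // N.Normal} :=
  haveI := N.2
  ⟨(pPrimeRadical p (G ⧸ N.1)).comap (QuotientGroup.mk' N.1), inferInstance⟩

/-- The terms `N₀ ≤ N₁ ≤ ⋯` of the upper `p`-series `1 = P₀ ≤ N₀ ≤ P₁ ≤ N₁ ≤ ⋯` of `G`, where
`N_k / P_k = O_{p'}(G / P_k)` and `P_{k+1} / N_k = O_p(G / N_k)`. -/
def upperPSeries (p : ℕ) (G : Type*) [Group G] : ℕ → {N : Subgroup G // N.Normal}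
  | 0 => pPrimeRadicalOver p ⟨⊥, inferInstance⟩
  | k + 1 => pPrimeRadicalOver p (pRadicalOver p (upperPSeries p G k))

/-- The `p`-length of `G`: the least `l` with `N_l = G` in the upper `p`-series (`⊤` if there is
no such `l`, which for finite `G` means that `G` is not `p`-soluble). -/
noncomputable def pLength (p : ℕ) (G : Type*) [Group G] : ℕ∞ :=
  ⨅ (l : ℕ) (_ : (upperPSeries p G l).1 = ⊤), (l : ℕ∞)

/-!
Factoring out `O_{p'}(G)`, one has to show that `P` is normal in `G` if `O_{p'}(G) = 1`. Call a
normal subgroup of `G` good if it is a `p`-group centralized by all `p'`-elements of the normal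
closure `Y` of `P`. If `Y` is good, then `Y = P`. Otherwise let `L ≤ Y` be a normal subgroup which
is minimal subject to not being good. Since products of good subgroups are good, there is a largest
normal subgroup `K` of `G` properly contained in `L`, and `K` is good. This uniqueness implies that
each chief series of `G` has a term `B` such that `L B / B` is the next factor and `L ∩ B = K`
(`PartialPiProperty.hasPrimePowerIndexSections`). At that factor the partial `Π`-property of a
`p`-subgroup `H` says that the normalizer of `(H ∩ L B) B` has `p`-power index. If `P` normalizes
such a subgroup as well, it is normal in `G` (`Sylow.normal_of_le_normalizer`).

* If `L` is not a `p`-group, then no `H ≤ P` of order `p ^ 2` contributes to `L / K`, so that `K`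
  contains all elements of order dividing `p ^ 2` of `L`. Moreover `L` is generated by
  `p'`-elements, and these centralize `K`. A `p'`-element centralizing all elements of order
  dividing `p ^ 2` of a `p`-group it normalizes centralizes that group
  (`commute_of_commute_pow_sq`), so Frobenius' argument and the focal subgroup theorem apply to
  `L` (`LocallyPNilpotent.sylow_eq_bot`). They show that `L` is a `p'`-group, so `L ≤ O_{p'}(G) = 1`.
* If `L` is a `p`-group and `K ≠ 1`, then either `L` is good by coprime action, or
  `L = [L, C(K)]` has class at most two and exponent dividing `p ^ 2`. In the latter case, any
  `x` in `L` outside `K` fixed by `P` modulo `K` lies in a subgroup `H` of order `p ^ 2` with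
  `H K = ⟨x⟩ K`. Hence `L = ⟨x⟩ K`, the group `Y` centralizes `L / K`, and by
  coprime action `L` is good (`IsLargestNormalBelow.isCentralizedPGroup_of_ne_bot`).
* If `L` is a `p`-group and `K = 1`, then `L` is a minimal normal subgroup, and several choices of
  `H` show that `P` centralizes `L` (`IsLargestNormalBelow.isCentralizedPGroup_of_bot`).
-/

section

open scoped commutatorElement

variable {G : Type*} [Group G] {p : ℕ}

/-! ### Preliminaries on `p`-groups -/

theorem Sylow.normal_of_le_normalizer [Finite G] [Fact p.Prime] (P : Sylow p G) {S : Subgroup G}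
    (hP : (P : Subgroup G) ≤ Subgroup.normalizer (S : Set G)) {n : ℕ}
    (hn : (Subgroup.normalizer (S : Set G)).index = p ^ n) : S.Normal := by
  have h1 : p ^ n ∣ (P : Subgroup G).index := hn ▸ Subgroup.index_dvd_of_le hP
  have h2 : n = 0 := by
    by_contra h0
    exact P.not_dvd_index ((dvd_pow_self p h0).trans h1)
  rw [h2, pow_zero, Subgroup.index_eq_one] at hn
  exact Subgroup.normalizer_eq_top_iff.mp hn

theorem IsPGroup.exists_mem_center_of_normal [Finite G] [Fact p.Prime] (hG : IsPGroup p G)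
    (N : Subgroup G) [N.Normal] (hN : N ≠ ⊥) : ∃ b ∈ N, b ≠ 1 ∧ ∀ u, u * b = b * u := by
  have hG' : IsPGroup p (ConjAct G) := hG.of_equiv ConjAct.toConjAct
  have hcard : p ∣ Nat.card N := by
    rcases (hG.to_subgroup N).card_eq_or_dvd with h | h
    · exact absurd (Subgroup.card_eq_one.mp h) hN
    · exact h
  obtain ⟨b, hb, hb1⟩ := hG'.exists_fixed_point_of_prime_dvd_card_of_fixed_point N hcard
    (a := 1) (by intro g; simp)
  refine ⟨b, b.2, fun h => hb1 (Subtype.ext h.symm), fun u => ?_⟩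
  have := congrArg Subtype.val (hb (ConjAct.toConjAct u))
  rw [ConjAct.Subgroup.val_conj_smul, ConjAct.toConjAct_smul] at this
  exact mul_inv_eq_iff_eq_mul.mp this

/-- A `p`-group `P` acting by conjugation on a section `B / A` of `P` has a nontrivial fixed
point. -/
theorem IsPGroup.exists_commutator_mem [Finite G] [Fact p.Prime] {P A B : Subgroup G}
    (hP : IsPGroup p P) (hAB : A < B) (hBP : B ≤ P)
    (hA : P ≤ Subgroup.normalizer (A : Set G)) (hB : P ≤ Subgroup.normalizer (B : Set G)) :
    ∃ b ∈ B, b ∉ A ∧ ∀ u ∈ P, u * b * u⁻¹ * b⁻¹ ∈ A := by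
  have hAP := hAB.le.trans hBP
  have : (A.subgroupOf P).Normal := (Subgroup.normal_subgroupOf_iff_le_normalizer hAP).mpr hA
  have : (B.subgroupOf P).Normal := (Subgroup.normal_subgroupOf_iff_le_normalizer hBP).mpr hB
  set f := QuotientGroup.mk' (A.subgroupOf P)
  have : ((B.subgroupOf P).map f).Normal :=
    Subgroup.Normal.map inferInstance f (QuotientGroup.mk'_surjective _)
  have hne : (B.subgroupOf P).map f ≠ ⊥ := by
    intro h
    rw [Subgroup.map_eq_bot_iff, QuotientGroup.ker_mk'] at h
    refine hAB.not_ge fun b hb => ?_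
    exact Subgroup.mem_subgroupOf.mp (h (Subgroup.mem_subgroupOf.mpr hb : (⟨b, hBP hb⟩ : P) ∈ _))
  obtain ⟨c, ⟨b, hb, rfl⟩, hb1, hc⟩ :=
    (hP.to_quotient (A.subgroupOf P)).exists_mem_center_of_normal _ hne
  refine ⟨b, hb, fun h => hb1 ((QuotientGroup.eq_one_iff _).mpr h), fun u hu => ?_⟩
  have h1 : f (⟨u, hu⟩ * b * ⟨u, hu⟩⁻¹ * b⁻¹) = 1 := by
    simp only [map_mul, map_inv, hc (f ⟨u, hu⟩)]
    group
  have h2 : (⟨u, hu⟩ * b * ⟨u, hu⟩⁻¹ * b⁻¹ : P) ∈ A.subgroupOf P :=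
    (QuotientGroup.eq_one_iff _).mp h1
  exact Subgroup.mem_subgroupOf.mp h2

/-- The subgroup `[Q, Q] Q ^ p`, which for a finite `p`-group `Q` is the Frattini subgroup. -/
def pFrattini (p : ℕ) (Q : Subgroup G) : Subgroup G :=
  ⁅Q, Q⁆ ⊔ Subgroup.closure ((· ^ p) '' (Q : Set G))

theorem pFrattini_le (Q : Subgroup G) : pFrattini p Q ≤ Q := by
  refine sup_le ?_ ?_
  · rw [Subgroup.commutator_le]
    intro a ha b hb
    exact Q.mul_mem (Q.mul_mem (Q.mul_mem ha hb) (Q.inv_mem ha)) (Q.inv_mem hb)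
  · rw [Subgroup.closure_le]
    rintro _ ⟨x, hx, rfl⟩
    exact Q.pow_mem hx p

theorem pow_mem_pFrattini {Q : Subgroup G} {x : G} (hx : x ∈ Q) : x ^ p ∈ pFrattini p Q :=
  Subgroup.mem_sup_right (Subgroup.subset_closure ⟨x, hx, rfl⟩)

theorem commutator_mem_pFrattini {Q : Subgroup G} {x y : G} (hx : x ∈ Q) (hy : y ∈ Q) :
    ⁅x, y⁆ ∈ pFrattini p Q :=
  Subgroup.mem_sup_left (Subgroup.commutator_mem_commutator hx hy)

theorem map_pFrattini {H : Type*} [Group H] (f : G →* H) (Q : Subgroup G) :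
    (pFrattini p Q).map f = pFrattini p (Q.map f) := by
  rw [pFrattini, pFrattini, Subgroup.map_sup, Subgroup.map_commutator, MonoidHom.map_closure]
  congr 2
  ext y
  simp

theorem normalizer_le_normalizer_pFrattini (Q : Subgroup G) :
    Subgroup.normalizer (Q : Set G) ≤ Subgroup.normalizer (pFrattini p Q : Set G) := by
  intro g hg
  rw [Subgroup.mem_normalizer_iff_map_conj_eq] at hg ⊢
  rw [map_pFrattini, hg]

theorem pFrattini_normal (Q : Subgroup G) [Q.Normal] : (pFrattini p Q).Normal := by
  rw [← Subgroup.normalizer_eq_top_iff, eq_top_iff]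
  exact (Subgroup.normalizer_eq_top (H := Q)).ge.trans (normalizer_le_normalizer_pFrattini Q)

theorem pFrattini_lt [Finite G] [Fact p.Prime] {Q : Subgroup G} (hQ : IsPGroup p Q)
    (hne : Q ≠ ⊥) : pFrattini p Q < Q := by
  have hp : p.Prime := Fact.out
  have : Nontrivial Q := (Subgroup.nontrivial_iff_ne_bot Q).mpr hne
  obtain ⟨n, hn0, hn⟩ := hQ.nontrivial_iff_card.mp inferInstance
  obtain ⟨m, rfl⟩ : ∃ m, n = m + 1 := ⟨n - 1, by omega⟩
  -- A subgroup `M` of index `p` in `Q` contains all commutators and `p`-th powers.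
  obtain ⟨M, hM⟩ := Sylow.exists_subgroup_card_pow_prime (G := Q) p (n := m)
    (hn ▸ pow_dvd_pow p (Nat.le_succ m))
  have hidx : M.index = p := by
    have := M.card_mul_index
    rw [hM, hn, pow_succ] at this
    exact Nat.eq_of_mul_eq_mul_left (pow_pos hp.pos m) this
  have : M.Normal := by
    refine Subgroup.normal_of_index_eq_minFac_card ?_
    rw [hidx, hn, hp.pow_minFac (Nat.succ_ne_zero m)]
  have hcardQ : Nat.card (Q ⧸ M) = p := by rw [← hidx, Subgroup.index_eq_card]
  have hcomm : ∀ a b : Q ⧸ M, a * b = b * a := by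
    have := isCyclic_of_prime_card hcardQ
    exact IsCyclic.commGroup.mul_comm
  have hle : pFrattini p Q ≤ M.map Q.subtype := by
    refine sup_le ?_ ?_
    · rw [Subgroup.commutator_le]
      intro a ha b hb
      refine ⟨⁅(⟨a, ha⟩ : Q), (⟨b, hb⟩ : Q)⁆, ?_, rfl⟩
      refine (QuotientGroup.eq_one_iff _).mp ?_
      show ((⟨a, ha⟩ : Q) : Q ⧸ M) * ((⟨b, hb⟩ : Q) : Q ⧸ M) * ((⟨a, ha⟩ : Q) : Q ⧸ M)⁻¹ *
        ((⟨b, hb⟩ : Q) : Q ⧸ M)⁻¹ = 1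
      rw [hcomm ((⟨a, ha⟩ : Q) : Q ⧸ M)]
      group
    · rw [Subgroup.closure_le]
      rintro _ ⟨x, hx, rfl⟩
      exact ⟨⟨x, hx⟩ ^ p, hidx ▸ Subgroup.pow_index_mem M _, rfl⟩
  refine lt_of_le_of_ne (pFrattini_le Q) fun h => ?_
  have h1 : M = ⊤ := by
    rw [eq_top_iff]
    rintro ⟨x, hx⟩ -
    obtain ⟨y, hy, hyx⟩ := hle (h ▸ hx)
    exact (Subtype.ext hyx : y = ⟨x, hx⟩) ▸ hy
  rw [h1, Subgroup.index_top] at hidx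
  exact hp.one_lt.ne hidx

/-- Coprime action: a `p'`-element `t` that centralizes the `p`-group `K` and fixes `x` modulo `K`
commutes with `x`. -/
theorem commute_of_commutator_mem [Fact p.Prime] {K : Subgroup G} (hK : IsPGroup p K) {t x : G}
    (ht : (orderOf t).Coprime p) (hKt : ∀ k ∈ K, Commute t k) (hx : t * x * t⁻¹ * x⁻¹ ∈ K) :
    Commute t x := by
  set k := t * x * t⁻¹ * x⁻¹ with hk
  have hkx : t * x * t⁻¹ = k * x := by rw [hk]; group
  have key : ∀ n : ℕ, t ^ n * x * (t ^ n)⁻¹ = k ^ n * x := by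
    intro n
    induction n with
    | zero => simp
    | succ n ih =>
      have h1 : t * k ^ n * t⁻¹ = k ^ n := by
        rw [((hKt k hx).pow_right n).eq]; group
      calc t ^ (n + 1) * x * (t ^ (n + 1))⁻¹ = t * (t ^ n * x * (t ^ n)⁻¹) * t⁻¹ := by
            rw [pow_succ']; group
        _ = (t * k ^ n * t⁻¹) * (t * x * t⁻¹) := by
            rw [ih]; simp only [mul_assoc, inv_mul_cancel_left]
        _ = k ^ (n + 1) * x := by rw [h1, hkx, ← mul_assoc, pow_succ]
  have h1 : k ^ orderOf t = 1 := by
    have := key (orderOf t)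
    rw [pow_orderOf_eq_one, one_mul, inv_one, mul_one] at this
    exact (mul_eq_right.mp this.symm)
  obtain ⟨j, hj⟩ := (isPGroup_iff_pow_pow_eq_one.mp hK) ⟨k, hx⟩
  have hj' : k ^ p ^ j = 1 := congrArg Subtype.val hj
  have h2 : k = 1 := by
    rw [← orderOf_eq_one_iff]
    exact Nat.eq_one_of_dvd_coprimes (ht.pow_right j)
      (orderOf_dvd_of_pow_eq_one h1) (orderOf_dvd_of_pow_eq_one hj')
  rw [h2, one_mul] at hkx
  exact mul_inv_eq_iff_eq_mul.mp hkx

theorem mul_pow_of_commute_commutator {x y : G} (hx : Commute ⁅y, x⁆ x) (hy : Commute ⁅y, x⁆ y)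
    (n : ℕ) : (x * y) ^ n = x ^ n * y ^ n * ⁅y, x⁆ ^ n.choose 2 := by
  set c := ⁅y, x⁆ with hc
  have hyx : y * x = c * (x * y) := by rw [hc, commutatorElement_def]; group
  have h1 : ∀ n : ℕ, y ^ n * x = x * y ^ n * c ^ n := by
    intro n
    induction n with
    | zero => simp
    | succ n ih =>
      calc y ^ (n + 1) * x = y * (y ^ n * x) := by rw [pow_succ', mul_assoc]
        _ = (y * x) * y ^ n * c ^ n := by rw [ih]; group
        _ = c * (x * y ^ (n + 1)) * c ^ n := by rw [hyx, pow_succ']; group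
        _ = x * y ^ (n + 1) * c * c ^ n := by rw [(hx.mul_right (hy.pow_right (n + 1))).eq]
        _ = x * y ^ (n + 1) * c ^ (n + 1) := by rw [mul_assoc, ← pow_succ']
  induction n with
  | zero => simp
  | succ n ih =>
    have e1 : Commute (c ^ n.choose 2) (x * y) := (hx.mul_right hy).pow_left _
    have e2 : Commute (c ^ n) y := hy.pow_left _
    calc (x * y) ^ (n + 1) = x ^ n * y ^ n * (c ^ n.choose 2 * (x * y)) := by
          rw [pow_succ, ih, mul_assoc]
      _ = x ^ n * (y ^ n * x) * (y * c ^ n.choose 2) := by rw [e1.eq]; simp only [mul_assoc]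
      _ = x ^ n * x * y ^ n * (c ^ n * y) * c ^ n.choose 2 := by rw [h1]; simp only [mul_assoc]
      _ = x ^ (n + 1) * y ^ (n + 1) * (c ^ n * c ^ n.choose 2) := by
          rw [e2.eq, pow_succ, pow_succ]; simp only [mul_assoc]
      _ = _ := by rw [← pow_add, Nat.choose_succ_succ' n 1, Nat.choose_one_right]

/-- The three subgroups lemma in the form used below: if `[Q, R] = Q` and `R` centralizes the
`Q`-invariant subgroup `K`, then `Q` centralizes `K`. -/
theorem commute_of_commutator_eq {Q R K : Subgroup G} (hQ : ⁅Q, R⁆ = Q)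
    (hKQ : ⁅K, Q⁆ ≤ K) (hKR : ∀ k ∈ K, ∀ r ∈ R, Commute k r) : ∀ k ∈ K, ∀ x ∈ Q, Commute k x := by
  have h1 : ⁅K, R⁆ = ⊥ := by
    rw [Subgroup.commutator_eq_bot_iff_le_centralizer]
    intro k hk
    rw [Subgroup.mem_centralizer_iff]
    intro r hr
    exact (hKR k hk r hr).symm.eq
  have h2 : ⁅⁅Q, R⁆, K⁆ = ⊥ := by
    apply Subgroup.commutator_commutator_eq_bot_of_rotate
    · rw [Subgroup.commutator_comm R K, h1, Subgroup.commutator_bot_left]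
    · exact le_bot_iff.mp (h1 ▸ Subgroup.commutator_mono hKQ le_rfl)
  rw [hQ, Subgroup.commutator_eq_bot_iff_le_centralizer] at h2
  intro k hk x hx
  exact Subgroup.mem_centralizer_iff.mp (h2 hx) k hk

/-- If `[Q, R] = Q`, and `Q` and `R` centralize a subgroup containing `[Q, Q] Q ^ p`, then `Q` has
exponent dividing `p ^ 2`: taking `p ^ 2`-th powers is a homomorphism on `Q` which kills each
commutator `[x, r]`. -/
theorem pow_sq_eq_one_of_commutator_eq [Fact p.Prime] {Q R K : Subgroup G} (hQ : ⁅Q, R⁆ = Q)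
    (hΦ : pFrattini p Q ≤ K) (hKR : ∀ k ∈ K, ∀ r ∈ R, Commute k r)
    (hKQ : ∀ k ∈ K, ∀ x ∈ Q, Commute k x) : ∀ x ∈ Q, x ^ p ^ 2 = 1 := by
  have hp : p.Prime := Fact.out
  have hpow : ∀ x ∈ Q, x ^ p ∈ K := fun x hx => hΦ (pow_mem_pFrattini hx)
  have hmul : ∀ x ∈ Q, ∀ y ∈ Q, (x * y) ^ p ^ 2 = x ^ p ^ 2 * y ^ p ^ 2 := by
    intro x hx y hy
    have hc : ⁅y, x⁆ ∈ K := hΦ (commutator_mem_pFrattini hy hx)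
    have hcp : ⁅y, x⁆ ^ p = 1 := by
      have h1 : y * x * y⁻¹ = ⁅y, x⁆ * x := by rw [commutatorElement_def]; group
      have h2 : (y * x * y⁻¹) ^ p = x ^ p := by
        rw [conj_pow, ← (hKQ _ (hpow x hx) y hy).eq]; group
      rw [h1, (hKQ _ hc x hx).mul_pow] at h2
      exact mul_eq_right.mp h2
    have hdvd : p ∣ (p ^ 2).choose 2 :=
      hp.dvd_choose_pow two_ne_zero (by nlinarith [hp.two_le])
    obtain ⟨m, hm⟩ := hdvd
    rw [mul_pow_of_commute_commutator (hKQ _ hc x hx) (hKQ _ hc y hy), hm, pow_mul, hcp,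
      one_pow, mul_one]
  intro x hx
  rw [← hQ, Subgroup.commutator_def] at hx
  have hsub : ∀ z ∈ Subgroup.closure {g | ∃ g₁ ∈ Q, ∃ g₂ ∈ R, ⁅g₁, g₂⁆ = g}, z ∈ Q := by
    intro z hz; rwa [← Subgroup.commutator_def, hQ] at hz
  induction hx using Subgroup.closure_induction with
  | mem z hz =>
    have hz' := hsub z (Subgroup.subset_closure hz)
    obtain ⟨y, hy, r, hr, rfl⟩ := hz
    have h1 : ⁅y, r⁆ = y * (r * y⁻¹ * r⁻¹) := by rw [commutatorElement_def]; group
    have h2 : r * y⁻¹ * r⁻¹ ∈ Q := by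
      have := Q.mul_mem (Q.inv_mem hy) hz'
      rwa [h1, inv_mul_cancel_left] at this
    have h3 : y ^ p ^ 2 ∈ K := by rw [sq, pow_mul]; exact K.pow_mem (hpow y hy) p
    rw [h1, hmul y hy _ h2, conj_pow, inv_pow, ← (hKR _ (K.inv_mem h3) r hr).eq]
    group
  | one => exact one_pow _
  | mul a b ha hb iha ihb => rw [hmul a (hsub a ha) b (hsub b hb), iha, ihb, one_mul]
  | inv a ha iha => rw [inv_pow, iha, inv_one]

/-- A `p'`-element normalizing a finite `p`-group `Q` and centralizing all elements of `Q` of order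
dividing `p ^ 2` centralizes `Q`. -/
theorem commute_of_commute_pow_sq [Finite G] [Fact p.Prime] {t : G} (ht : (orderOf t).Coprime p)
    (Q : Subgroup G) (hQ : IsPGroup p Q) (htQ : t ∈ Subgroup.normalizer (Q : Set G))
    (hΩ : ∀ x ∈ Q, x ^ p ^ 2 = 1 → Commute t x) : ∀ x ∈ Q, Commute t x := by
  induction hc : Nat.card Q using Nat.strong_induction_on generalizing Q with
  | _ c ih =>
    subst hc
    have ih' : ∀ M : Subgroup G, M < Q → t ∈ Subgroup.normalizer (M : Set G) →
        ∀ x ∈ M, Commute t x := fun M hM hMt =>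
      ih _ (lt_of_not_ge fun h => hM.ne (Subgroup.eq_of_le_of_card_ge hM.le h)) M
        (hQ.to_le hM.le) hMt (fun x hx => hΩ x (hM.le hx)) rfl
    rcases eq_or_ne Q ⊥ with rfl | hne
    · intro x hx; rw [Subgroup.mem_bot.mp hx]; exact Commute.one_right t
    set R := Subgroup.zpowers t
    have hRQ : R ≤ Subgroup.normalizer (Q : Set G) := by rwa [Subgroup.zpowers_le]
    have hle : ⁅Q, R⁆ ≤ Q := by
      rw [Subgroup.commutator_le]
      intro q hq r hr
      rw [commutatorElement_def, mul_assoc, mul_assoc, ← mul_assoc r]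
      exact Q.mul_mem hq ((Subgroup.mem_normalizer_iff.mp (hRQ hr) _).mp (Q.inv_mem hq))
    have htR : t ∈ R := Subgroup.mem_zpowers t
    rcases hle.lt_or_eq with hlt | heq
    · have htD : t ∈ Subgroup.normalizer ((⁅Q, R⁆ : Subgroup G) : Set G) := by
        rw [Subgroup.mem_normalizer_iff_map_conj_eq] at htQ ⊢
        have h2 : R.map (MulAut.conj t).toMonoidHom = R :=
          Subgroup.mem_normalizer_iff_map_conj_eq.mp (R.le_normalizer htR)
        rw [Subgroup.map_commutator]
        exact congrArg₂ _ htQ h2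
      intro x hx
      refine commute_of_commutator_mem (hQ.to_le hle) ht (ih' _ hlt htD) ?_
      have := Subgroup.inv_mem _ (Subgroup.commutator_mem_commutator hx htR)
      rwa [commutatorElement_inv] at this
    · have hlt := pFrattini_lt hQ hne
      have hcK := ih' _ hlt (normalizer_le_normalizer_pFrattini Q htQ)
      have hKR : ∀ k ∈ pFrattini p Q, ∀ r ∈ R, Commute k r := by
        rintro k hk _ ⟨n, rfl⟩
        exact ((hcK k hk).zpow_left n).symm
      have hKQ := commute_of_commutator_eq heq
        (by
          rw [Subgroup.commutator_le]
          exact fun k hk q hq => commutator_mem_pFrattini (pFrattini_le Q hk) hq) hKR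
      exact fun x hx => hΩ x hx (pow_sq_eq_one_of_commutator_eq heq le_rfl hKR hKQ x hx)

/-! ### Fusion when `p'`-elements centralize the `p`-subgroups they normalize -/

/-- Every `p'`-element normalizing a `p`-subgroup `D` of `G` centralizes `D`. -/
def LocallyPNilpotent (p : ℕ) (G : Type*) [Group G] : Prop :=
  ∀ D : Subgroup G, IsPGroup p D → ∀ t ∈ Subgroup.normalizer (D : Set G),
    (orderOf t).Coprime p → ∀ d ∈ D, Commute t d

theorem exists_orderOf_pow_coprime [Finite G] [Fact p.Prime] (g : G) :
    ∃ k : ℕ, (orderOf (g ^ p ^ k)).Coprime p := by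
  have hp : p.Prime := Fact.out
  obtain ⟨k, m, hm, hk⟩ := Nat.exists_eq_pow_mul_and_not_dvd (orderOf_pos g).ne' p hp.ne_one
  refine ⟨k, ?_⟩
  rw [orderOf_pow_of_dvd (pow_pos hp.pos k).ne' ⟨m, hk⟩, hk,
    Nat.mul_div_cancel_left _ (pow_pos hp.pos k)]
  exact ((Nat.Prime.coprime_iff_not_dvd hp).mpr hm).symm

theorem LocallyPNilpotent.exists_eq_mul [Finite G] [Fact p.Prime] (hG : LocallyPNilpotent p G)
    {D N : Subgroup G} (hD : IsPGroup p D) (hN : N ≤ Subgroup.normalizer (D : Set G))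
    (S : Sylow p N) (n : N) :
    ∃ c s : N, (c : G) ∈ Subgroup.centralizer (D : Set G) ∧ s ∈ S ∧ n = c * s := by
  have hp : p.Prime := Fact.out
  set C := (Subgroup.centralizer (D : Set G)).subgroupOf N with hC
  have hCn : C.Normal := by
    refine ⟨fun c hc g => ?_⟩
    rw [hC, Subgroup.mem_subgroupOf, Subgroup.mem_centralizer_iff] at hc ⊢
    intro d hd
    have h1 : (g : G)⁻¹ * d * g ∈ D := (Subgroup.mem_normalizer_iff''.mp (hN g.2) d).mp hd
    have h2 := hc _ h1
    have h3 : d = g * ((g : G)⁻¹ * d * g) * (g : G)⁻¹ := by group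
    simp only [Subgroup.coe_mul, Subgroup.coe_inv]
    calc d * (g * c * (g : G)⁻¹) = g * (((g : G)⁻¹ * d * g) * c) * (g : G)⁻¹ := by group
      _ = g * (c * ((g : G)⁻¹ * d * g)) * (g : G)⁻¹ := by rw [h2]
      _ = _ := by group
  have hNC : IsPGroup p (N ⧸ C) := by
    rw [isPGroup_iff_pow_pow_eq_one]
    intro q
    obtain ⟨g, rfl⟩ := QuotientGroup.mk_surjective q
    obtain ⟨k, hk⟩ := exists_orderOf_pow_coprime (p := p) g
    refine ⟨k, ?_⟩
    rw [← QuotientGroup.mk_pow, QuotientGroup.eq_one_iff, hC, Subgroup.mem_subgroupOf,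
      Subgroup.mem_centralizer_iff]
    intro d hd
    refine (hG D hD _ (hN (g ^ p ^ k).2) ?_ d hd).symm.eq
    rwa [Subgroup.orderOf_coe]
  have htop : C ⊔ (S : Subgroup N) = ⊤ := by
    obtain ⟨m, hm⟩ := IsPGroup.iff_card.mp hNC
    rw [← Subgroup.index_eq_card] at hm
    have h1 : (C ⊔ (S : Subgroup N)).index ∣ p ^ m := hm ▸ Subgroup.index_dvd_of_le le_sup_left
    have h2 : (C ⊔ (S : Subgroup N)).index ∣ (S : Subgroup N).index :=
      Subgroup.index_dvd_of_le le_sup_right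
    rw [← Subgroup.index_eq_one]
    refine Nat.eq_one_of_dvd_coprimes ?_ h1 h2
    exact Nat.Coprime.pow_left m ((Nat.Prime.coprime_iff_not_dvd hp).mpr S.not_dvd_index)
  have hn : n ∈ C ⊔ (S : Subgroup N) := htop ▸ Subgroup.mem_top n
  obtain ⟨c, hc, s, hs, rfl⟩ := Subgroup.mem_sup_of_normal_left.mp hn
  exact ⟨c, s, hc, hs, rfl⟩

theorem IsPGroup.exists_mem_normalizer [Finite G] [Fact p.Prime] {P D : Subgroup G}
    (hP : IsPGroup p P) (hD : D < P) : ∃ x ∈ P, x ∈ Subgroup.normalizer (D : Set G) ∧ x ∉ D := by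
  have := hP.isNilpotent
  have h1 : D.subgroupOf P < ⊤ := by
    rw [lt_top_iff_ne_top, Ne, Subgroup.subgroupOf_eq_top]
    exact hD.not_ge
  have h2 := Group.normalizerCondition_of_isNilpotent (G := P) _ h1
  rw [← Subgroup.subgroupOf_normalizer_eq hD.le] at h2
  obtain ⟨x, hx, hxD⟩ := SetLike.exists_of_lt h2
  exact ⟨x, x.2, hx, hxD⟩

/-- Any two Sylow `p`-subgroups are conjugate by an element centralizing their intersection; by
downward induction on the order of the intersection. -/
theorem LocallyPNilpotent.exists_smul_eq [Finite G] [Fact p.Prime] (hG : LocallyPNilpotent p G)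
    (P Q : Sylow p G) :
    ∃ c ∈ Subgroup.centralizer (((P : Subgroup G) ⊓ Q : Subgroup G) : Set G), c • P = Q := by
  induction hc : Nat.card G - Nat.card ((P : Subgroup G) ⊓ Q : Subgroup G) using
    Nat.strong_induction_on generalizing P Q with
  | _ m ih =>
    subst hc
    have ih' : ∀ P' Q' : Sylow p G, (P : Subgroup G) ⊓ Q < (P' : Subgroup G) ⊓ Q' →
        ∃ c ∈ Subgroup.centralizer (((P : Subgroup G) ⊓ Q : Subgroup G) : Set G),
          c • P' = Q' := by
      intro P' Q' hlt
      have h1 : Nat.card ((P : Subgroup G) ⊓ Q : Subgroup G) <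
          Nat.card ((P' : Subgroup G) ⊓ Q' : Subgroup G) :=
        lt_of_not_ge fun h => hlt.ne (Subgroup.eq_of_le_of_card_ge hlt.le h)
      have h2 := Subgroup.card_le_card_group ((P' : Subgroup G) ⊓ Q')
      obtain ⟨c, hc, hcP⟩ := ih _ (by omega) P' Q' rfl
      exact ⟨c, Subgroup.centralizer_le hlt.le hc, hcP⟩
    set D := (P : Subgroup G) ⊓ Q with hDdef
    rcases eq_or_ne P Q with rfl | hne
    · exact ⟨1, one_mem _, one_smul _ _⟩
    have hDP : D < P := by
      refine lt_of_le_of_ne inf_le_left fun h => hne ?_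
      exact Sylow.ext (P.is_maximal' Q.2 (inf_eq_left.mp h)).symm
    have hDQ : D < Q := by
      refine lt_of_le_of_ne inf_le_right fun h => hne ?_
      exact Sylow.ext (Q.is_maximal' P.2 (inf_eq_right.mp h))
    have hD : IsPGroup p D := P.2.to_le hDP.le
    obtain ⟨x, hxP, hxN, hxD⟩ := P.2.exists_mem_normalizer hDP
    obtain ⟨y, hyQ, hyN, hyD⟩ := Q.2.exists_mem_normalizer hDQ
    set N := Subgroup.normalizer (D : Set G)
    have hDN : D ≤ N := D.le_normalizer
    obtain ⟨S₁, hS₁⟩ := (P.2.comap_subtype (K := N)).exists_le_sylow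
    obtain ⟨S₂, hS₂⟩ := (Q.2.comap_subtype (K := N)).exists_le_sylow
    obtain ⟨n, hn⟩ := MulAction.exists_smul_eq N S₁ S₂
    obtain ⟨c, s, hc, hs, rfl⟩ := hG.exists_eq_mul hD le_rfl S₁ n
    have hsS : s • S₁ = S₁ :=
      Sylow.smul_eq_iff_mem_normalizer.mpr (Subgroup.le_normalizer hs)
    rw [mul_smul, hsS] at hn
    obtain ⟨T, hT⟩ := (S₁.2.map N.subtype).exists_le_sylow
    obtain ⟨c₁, hc₁, hcP⟩ := ih' P T (by
      refine lt_of_le_of_ne (le_inf hDP.le fun d hd => hT ⟨⟨d, hDN hd⟩, hS₁ (hDP.le hd), rfl⟩) ?_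
      intro h
      refine hxD (h.ge ⟨hxP, hT ⟨⟨x, hxN⟩, hS₁ hxP, rfl⟩⟩))
    have hQT : ∀ q ∈ Q, q ∈ N → q ∈ ((c : G) • T : Sylow p G) := by
      intro q hq hqN
      have h1 : (⟨q, hqN⟩ : N) ∈ c • S₁ := hn ▸ hS₂ hq
      change _ ∈ ((c • S₁ : Sylow p N) : Subgroup N) at h1
      change q ∈ (((c : G) • T : Sylow p G) : Subgroup G)
      rw [Sylow.coe_subgroup_smul] at h1 ⊢
      rw [Subgroup.mem_pointwise_smul_iff_inv_smul_mem] at h1 ⊢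
      exact hT ⟨_, h1, by simp [MulAut.smul_def]⟩
    obtain ⟨c₂, hc₂, hcQ⟩ := ih' ((c : G) • T) Q (by
      refine lt_of_le_of_ne (le_inf (fun d hd => hQT d (hDQ.le hd) (hDN hd)) hDQ.le) ?_
      intro h
      exact hyD (h.ge ⟨hQT y hyQ hyN, hyQ⟩))
    refine ⟨c₂ * c * c₁, mul_mem (mul_mem hc₂ hc) hc₁, ?_⟩
    rw [mul_smul, mul_smul, hcP, hcQ]

theorem LocallyPNilpotent.exists_conj_eq [Finite G] [Fact p.Prime] (hG : LocallyPNilpotent p G)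
    (P : Sylow p G) {x g : G} (hx : x ∈ P) (hg : g * x * g⁻¹ ∈ P) :
    ∃ u ∈ P, g * x * g⁻¹ = u * x * u⁻¹ := by
  obtain ⟨c, hc, hcP⟩ := hG.exists_smul_eq P (g⁻¹ • P)
  have hxQ : x ∈ (g⁻¹ • P : Sylow p G) := by
    change x ∈ ((g⁻¹ • P : Sylow p G) : Subgroup G)
    rw [Sylow.coe_subgroup_smul, Subgroup.mem_pointwise_smul_iff_inv_smul_mem]
    simpa [MulAut.smul_def] using (show _ ∈ (P : Subgroup G) from hg)
  have hcx : x * c = c * x := Subgroup.mem_centralizer_iff.mp hc x ⟨hx, hxQ⟩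
  have hn : g * c ∈ Subgroup.normalizer (P : Set G) := by
    rw [← Sylow.smul_eq_iff_mem_normalizer, mul_smul, hcP, smul_inv_smul]
  obtain ⟨a, s, ha, hs, has⟩ := hG.exists_eq_mul P.2 le_rfl (P.subtype Subgroup.le_normalizer)
    ⟨(g * c)⁻¹, inv_mem hn⟩
  have has' : (g * c)⁻¹ = a * s := congrArg Subtype.val has
  have hsP : (s : G) ∈ P := hs
  have hax : x * a = a * x := Subgroup.mem_centralizer_iff.mp ha x hx
  refine ⟨(s : G)⁻¹, inv_mem hsP, ?_⟩
  have h1 : g * x * g⁻¹ = (g * c) * x * (g * c)⁻¹ := by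
    calc g * x * g⁻¹ = g * (x * c) * c⁻¹ * g⁻¹ := by group
      _ = _ := by rw [hcx]; group
  have h2 : g * c = (s : G)⁻¹ * (a : G)⁻¹ := by rw [← mul_inv_rev, ← has', inv_inv]
  rw [h1, has', h2]
  calc (s : G)⁻¹ * (a : G)⁻¹ * x * (a * s) = (s : G)⁻¹ * ((a : G)⁻¹ * (x * a)) * s := by group
    _ = _ := by rw [hax]; group

/-- A case of Frobenius' normal `p`-complement theorem: `P` controls its own fusion, so by the focal
subgroup theorem `P / [P, P]` is a homomorphic image of `G`, which is trivial if `G` is generated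
by `p'`-elements. -/
theorem LocallyPNilpotent.sylow_eq_bot [Finite G] [Fact p.Prime] (hG : LocallyPNilpotent p G)
    (hgen : Subgroup.closure {t : G | (orderOf t).Coprime p} = ⊤) (P : Sylow p G) :
    (P : Subgroup G) = ⊥ := by
  by_contra hne
  have hfoc : (P : Subgroup G).focalSubgroup ≤ ⁅(P : Subgroup G), (P : Subgroup G)⁆ := by
    rw [Subgroup.focalSubgroup_def, Subgroup.closure_le]
    rintro _ ⟨hP, x, hx, u, rfl⟩
    have h1 : ⁅x, u⁆ = x * (u * x⁻¹ * u⁻¹) := by rw [commutatorElement_def]; group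
    have h2 : u * x⁻¹ * u⁻¹ ∈ P := by
      have := mul_mem (inv_mem hx) hP
      rwa [h1, inv_mul_cancel_left] at this
    obtain ⟨v, hv, hvx⟩ := hG.exists_conj_eq P (inv_mem hx) h2
    have h3 : ⁅x, u⁆ = ⁅x, v⁆ := by rw [h1, hvx, commutatorElement_def]; group
    rw [h3]
    exact Subgroup.commutator_mem_commutator hx hv
  have hlt : (P : Subgroup G).focalSubgroup < P :=
    (hfoc.trans le_sup_left).trans_lt (pFrattini_lt P.2 hne)
  have hker : (P : Subgroup G).transferFocal.ker = ⊤ := by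
    rw [eq_top_iff, ← hgen, Subgroup.closure_le]
    intro t ht
    rw [SetLike.mem_coe, MonoidHom.mem_ker]
    have hQ : IsPGroup p (P ⧸ (P : Subgroup G).focalSubgroupOf) := P.2.to_quotient _
    obtain ⟨k, hk⟩ := hQ ((P : Subgroup G).transferFocal t)
    rw [← orderOf_eq_one_iff]
    exact Nat.eq_one_of_dvd_coprimes (Nat.Coprime.pow_right k ht) (orderOf_map_dvd _ t)
      (orderOf_dvd_of_pow_eq_one hk)
  have h1 := Subgroup.ker_transferFocal_inf_eq_focalSubgroup P
  rw [hker, top_inf_eq] at h1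
  exact hlt.ne h1.symm

/-! ### The index condition on a section with unique maximal normal subgroup -/

/-- `K` is the largest among the normal subgroups of `G` properly contained in the normal
subgroup `L`. -/
structure IsLargestNormalBelow (K L : Subgroup G) : Prop where
  normal_bot : K.Normal
  normal_top : L.Normal
  lt : K < L
  le_of_lt : ∀ M : Subgroup G, M.Normal → M < L → M ≤ K

/-- The consequence of the partial `Π`-property for a `p`-subgroup `H` used below. A chief series
of `G` has a term `B` for which `L B / B` is the next chief factor and `L ∩ B = K`, whenever `K` is
the largest normal subgroup of `G` below `L`. -/
def HasPrimePowerIndexSections (p : ℕ) (H : Subgroup G) : Prop :=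
  ∀ K L : Subgroup G, IsLargestNormalBelow K L → ∃ B : Subgroup G, B.Normal ∧ L ⊓ B = K ∧
    ∃ n, (Subgroup.normalizer ((H ⊓ (L ⊔ B) ⊔ B : Subgroup G) : Set G)).index = p ^ n

/-- The normal subgroup `M` is a `p`-group centralized by all `p'`-elements of the normal closure
of `P`. -/
def IsCentralizedPGroup (p : ℕ) (P M : Subgroup G) : Prop :=
  IsPGroup p M ∧ ∀ t ∈ Subgroup.normalClosure (P : Set G), (orderOf t).Coprime p →
    ∀ m ∈ M, Commute t m

theorem Subgroup.sup_inf_eq_of_le {A L : Subgroup G} (B : Subgroup G) [B.Normal] (h : A ≤ L) :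
    (A ⊔ B) ⊓ L = A ⊔ L ⊓ B := by
  apply le_antisymm
  · rintro x ⟨hx, hxL⟩
    obtain ⟨a, ha, b, hb, rfl⟩ := Subgroup.mem_sup_of_normal_right.mp hx
    refine Subgroup.mul_mem_sup ha ⟨?_, hb⟩
    have := mul_mem (inv_mem (h ha)) hxL
    rwa [inv_mul_cancel_left] at this
  · exact sup_le (le_inf le_sup_left h) (le_inf (inf_le_right.trans le_sup_right) inf_le_left)

theorem Subgroup.index_normalizer_inf [Fact p.Prime] {X : Subgroup G} (L : Subgroup G) [L.Normal]
    {n : ℕ} (hn : (Subgroup.normalizer (X : Set G)).index = p ^ n) :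
    ∃ m, (Subgroup.normalizer ((X ⊓ L : Subgroup G) : Set G)).index = p ^ m := by
  have hle : Subgroup.normalizer (X : Set G) ≤
      Subgroup.normalizer ((X ⊓ L : Subgroup G) : Set G) := by
    refine le_trans (le_inf le_rfl ?_) Subgroup.inf_normalizer_le_normalizer_inf
    exact Subgroup.le_normalizer_of_normal
  obtain ⟨m, -, hm⟩ := (Nat.dvd_prime_pow Fact.out).mp (hn ▸ Subgroup.index_dvd_of_le hle)
  exact ⟨m, hm⟩

/-- If `N` has `p`-power index in `G`, then `G = P N`. -/
theorem Sylow.exists_mul_eq [Finite G] [Fact p.Prime] (P : Sylow p G) {N : Subgroup G} {n : ℕ}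
    (hN : N.index = p ^ n) (g : G) : ∃ u ∈ P, ∃ x ∈ N, g = u * x := by
  have hp : p.Prime := Fact.out
  have h1 : p ^ n ∣ N.relIndex P * (P : Subgroup G).index := by
    rw [← Subgroup.inf_relIndex_right, Subgroup.relIndex_mul_index inf_le_right, ← hN]
    exact Subgroup.index_dvd_of_le inf_le_left
  have h2 : p ^ n ∣ N.relIndex P :=
    Nat.Coprime.dvd_of_dvd_mul_right
      (Nat.Coprime.pow_left n ((Nat.Prime.coprime_iff_not_dvd hp).mpr P.not_dvd_index)) h1
  have hst : MulAction.stabilizer P ((1 : G) : G ⧸ N) = N.subgroupOf P := by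
    ext u
    rw [MulAction.mem_stabilizer_iff, Subgroup.mem_subgroupOf]
    change (((u : G) * 1 : G) : G ⧸ N) = ((1 : G) : G ⧸ N) ↔ _
    rw [QuotientGroup.eq, mul_one, mul_one, inv_mem_iff]
  have horb : MulAction.orbit P ((1 : G) : G ⧸ N) = Set.univ := by
    have h3 : (MulAction.orbit P ((1 : G) : G ⧸ N)).ncard = N.relIndex P := by
      rw [← MulAction.index_stabilizer, hst, Subgroup.relIndex]
    have h4 : 0 < N.relIndex P := Nat.pos_of_ne_zero Subgroup.index_ne_zero_of_finite
    refine Set.eq_of_subset_of_ncard_le (Set.subset_univ _) ?_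
    rw [Set.ncard_univ, ← Subgroup.index_eq_card, hN, h3]
    exact Nat.le_of_dvd h4 h2
  obtain ⟨u, hu⟩ : (g : G ⧸ N) ∈ MulAction.orbit P ((1 : G) : G ⧸ N) := horb ▸ Set.mem_univ _
  have hu' : (((u : G) * 1 : G) : G ⧸ N) = (g : G ⧸ N) := hu
  rw [QuotientGroup.eq, mul_one] at hu'
  exact ⟨u, u.2, _, hu', by group⟩

/-- Let `K` be the largest normal subgroup below `L`, and suppose that `K` but not `L` is a
`p`-group. Then `H ∩ L ≤ K`: otherwise `L` is the normal closure of `(H ∩ L) K`, which is generated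
by conjugates under `P`, whence `L` lies in `P B` and `L / K` is a `p`-group. -/
theorem HasPrimePowerIndexSections.inf_le [Finite G] [Fact p.Prime] (P : Sylow p G)
    {H K L : Subgroup G} (hH : HasPrimePowerIndexSections p H) (hHP : H ≤ P)
    (hKL : IsLargestNormalBelow K L) (hK : IsPGroup p K) (hL : ¬ IsPGroup p L) : H ⊓ L ≤ K := by
  obtain ⟨B, hB, hBK, n, hn⟩ := hH K L hKL
  have := hKL.normal_top
  obtain ⟨m, hm⟩ := Subgroup.index_normalizer_inf L hn
  set X := (H ⊓ (L ⊔ B) ⊔ B) ⊓ L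
  have hHX : H ⊓ L ≤ X :=
    le_inf ((inf_le_inf_left H le_sup_left).trans le_sup_left) inf_le_right
  have hXL : X ≤ L := inf_le_right
  have hXP : X ≤ (P : Subgroup G) ⊔ B :=
    inf_le_left.trans (sup_le_sup_right (inf_le_left.trans hHP) B)
  have hcl : Subgroup.normalClosure (X : Set G) ≤ L := Subgroup.normalClosure_le_normal hXL
  rcases hcl.lt_or_eq with hlt | heq
  · exact hHX.trans (Subgroup.subset_normalClosure.trans
      (hKL.le_of_lt _ Subgroup.normalClosure_normal hlt))
  · exfalso
    have hLP : L ≤ (P : Subgroup G) ⊔ B := by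
      rw [← heq, Subgroup.normalClosure, Subgroup.closure_le]
      intro y hy
      obtain ⟨x, hx, hxy⟩ := Group.mem_conjugatesOfSet_iff.mp hy
      obtain ⟨g, rfl⟩ := isConj_iff.mp hxy
      obtain ⟨u, hu, v, hv, rfl⟩ := P.exists_mul_eq hm g
      have h1 : v * x * v⁻¹ ∈ X := (Subgroup.mem_normalizer_iff.mp hv x).mp hx
      have hu' : u ∈ (P : Subgroup G) ⊔ B := Subgroup.mem_sup_left hu
      have h2 : u * v * x * (u * v)⁻¹ = u * (v * x * v⁻¹) * u⁻¹ := by group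
      rw [h2]
      exact mul_mem (mul_mem hu' (hXP h1)) (inv_mem hu')
    refine hL (isPGroup_iff_pow_pow_eq_one.mpr ?_)
    rintro ⟨l, hl⟩
    have hPB : IsPGroup p (((P : Subgroup G) ⊔ B).map (QuotientGroup.mk' B)) := by
      rw [Subgroup.map_sup, QuotientGroup.map_mk'_self, sup_bot_eq]
      exact P.2.map _
    obtain ⟨k, hk⟩ := isPGroup_iff_pow_pow_eq_one.mp hPB ⟨_, ⟨l, hLP hl, rfl⟩⟩
    have hk' : ((l ^ p ^ k : G) : G ⧸ B) = 1 := congrArg Subtype.val hk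
    have hlK : l ^ p ^ k ∈ K := hBK ▸ ⟨pow_mem hl _, (QuotientGroup.eq_one_iff _).mp hk'⟩
    obtain ⟨j, hj⟩ := isPGroup_iff_pow_pow_eq_one.mp hK ⟨_, hlK⟩
    refine ⟨k + j, Subtype.ext ?_⟩
    have hj' : (l ^ p ^ k) ^ p ^ j = 1 := congrArg Subtype.val hj
    simpa [pow_add, pow_mul] using hj'

theorem IsPGroup.exists_le_card_eq_sq [Finite G] [Fact p.Prime] {P : Subgroup G}
    (hP : IsPGroup p P) (hcard : p ^ 2 ≤ Nat.card P) {x : G} (hx : x ∈ P) (hxp : x ^ p ^ 2 = 1) :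
    ∃ H ≤ P, Nat.card H = p ^ 2 ∧ x ∈ H := by
  have hp : p.Prime := Fact.out
  obtain ⟨n, hn⟩ := IsPGroup.iff_card.mp hP
  have h2n : 2 ≤ n := (Nat.pow_le_pow_iff_right hp.one_lt).mp (hn ▸ hcard)
  obtain ⟨j, hj, hjo⟩ := (Nat.dvd_prime_pow hp).mp (orderOf_dvd_of_pow_eq_one hxp)
  obtain ⟨H, hH, hle⟩ := Sylow.exists_subgroup_card_pow_prime_le (G := P) p (n := j) (m := 2)
    (hn ▸ pow_dvd_pow p h2n) (Subgroup.zpowers ⟨x, hx⟩)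
    (by rw [Nat.card_zpowers, Subgroup.orderOf_mk, hjo]) hj
  refine ⟨H.map P.subtype, Subgroup.map_subtype_le H, ?_, ?_⟩
  · rw [Subgroup.card_map_of_injective P.subtype_injective, hH]
  · exact ⟨⟨x, hx⟩, hle (Subgroup.mem_zpowers _), rfl⟩

/-! ### Sections that are not `p`-groups -/

/-- If `L` is not a `p`-group, then it is generated by its `p'`-elements, so that `K` is central in
`L` and contains all elements of order dividing `p ^ 2` of `L`. Therefore `L` is a `p'`-group. -/
theorem IsLargestNormalBelow.isPGroup [Finite G] [Fact p.Prime] (P : Sylow p G)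
    (hcard : p ^ 2 ≤ Nat.card P)
    (hP : ∀ H ≤ (P : Subgroup G), Nat.card H = p ^ 2 → HasPrimePowerIndexSections p H)
    (hO : ∀ N : Subgroup G, N.Normal → (Nat.card N).Coprime p → N = ⊥)
    {K L : Subgroup G} (hKL : IsLargestNormalBelow K L)
    (hLP : L ≤ Subgroup.normalClosure (P : Set G)) (hK : IsCentralizedPGroup p (P : Subgroup G) K) :
    IsPGroup p L := by
  have hp : p.Prime := Fact.out
  have := hKL.normal_top
  have := hKL.normal_bot
  by_contra hL
  have hHK : ∀ H ≤ (P : Subgroup G), Nat.card H = p ^ 2 → H ⊓ L ≤ K := fun H hH hc =>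
    (hP H hH hc).inf_le P hH hKL hK.1 hL
  set W := Subgroup.closure {t : G | t ∈ L ∧ (orderOf t).Coprime p} with hW
  have hWn : W.Normal := by
    refine ⟨fun w hw g => ?_⟩
    have hle : W ≤ W.comap (MulAut.conj g).toMonoidHom := by
      refine (Subgroup.closure_le _).mpr fun t ht => Subgroup.subset_closure ⟨?_, ?_⟩
      · exact hKL.normal_top.conj_mem t ht.1 g
      · exact ((MulAut.conj g).orderOf_eq t).symm ▸ ht.2
    exact hle hw
  have hWL : W = L := by
    have hle : W ≤ L := (Subgroup.closure_le L).mpr fun t ht => ht.1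
    refine hle.lt_or_eq.resolve_left fun hlt => hL ?_
    have hWK := hKL.le_of_lt W hWn hlt
    rw [isPGroup_iff_pow_pow_eq_one]
    rintro ⟨l, hl⟩
    obtain ⟨k, hk⟩ := exists_orderOf_pow_coprime (p := p) l
    refine ⟨k, Subtype.ext ?_⟩
    have hlK : l ^ p ^ k ∈ K := hWK (Subgroup.subset_closure ⟨pow_mem hl _, hk⟩)
    obtain ⟨j, hj⟩ := isPGroup_iff_pow_pow_eq_one.mp hK.1 ⟨_, hlK⟩
    have hj' : (l ^ p ^ k) ^ p ^ j = 1 := congrArg Subtype.val hj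
    have h1 : orderOf (l ^ p ^ k) = 1 :=
      Nat.eq_one_of_dvd_coprimes (hk.pow_right j) dvd_rfl (orderOf_dvd_of_pow_eq_one hj')
    simpa using orderOf_eq_one_iff.mp h1
  have hKcentral : ∀ k ∈ K, ∀ l ∈ L, Commute l k := by
    intro k hk l hl
    have hle : W ≤ Subgroup.centralizer {k} := by
      rw [hW, Subgroup.closure_le]
      rintro t ⟨ht, hto⟩
      rw [SetLike.mem_coe, Subgroup.mem_centralizer_singleton_iff]
      exact hK.2 t (hLP ht) hto k hk
    rw [hWL] at hle
    exact Subgroup.mem_centralizer_singleton_iff.mp (hle hl)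
  have hΩ : ∀ x ∈ L, x ^ p ^ 2 = 1 → x ∈ K := by
    intro x hx hxp
    have hz : IsPGroup p (Subgroup.zpowers x) :=
      IsPGroup.of_card_dvd_pow (n := 2)
        (by rw [Nat.card_zpowers]; exact orderOf_dvd_of_pow_eq_one hxp)
    obtain ⟨Q, hQ⟩ := hz.exists_le_sylow
    obtain ⟨g, rfl⟩ := MulAction.exists_smul_eq G P Q
    have hgx : g⁻¹ * x * g ∈ (P : Subgroup G) := by
      have h1 : x ∈ ((g • P : Sylow p G) : Subgroup G) := hQ (Subgroup.mem_zpowers x)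
      rw [Sylow.coe_subgroup_smul, Subgroup.mem_pointwise_smul_iff_inv_smul_mem] at h1
      simpa [MulAut.smul_def] using h1
    have hgp : (g⁻¹ * x * g) ^ p ^ 2 = 1 := by
      have := conj_pow (i := p ^ 2) (a := g⁻¹) (b := x)
      rw [inv_inv] at this
      rw [this, hxp]; group
    obtain ⟨H, hHP, hHc, hxH⟩ := P.2.exists_le_card_eq_sq hcard hgx hgp
    have hgL : g⁻¹ * x * g ∈ L := by
      simpa using hKL.normal_top.conj_mem x hx g⁻¹
    have h2 := hKL.normal_bot.conj_mem _ (hHK H hHP hHc ⟨hxH, hgL⟩) g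
    have h3 : g * (g⁻¹ * x * g) * g⁻¹ = x := by group
    rwa [h3] at h2
  have hloc : LocallyPNilpotent p L := by
    intro D hD t ht hto
    refine commute_of_commute_pow_sq hto D hD ht fun x _ hxp => ?_
    have h1 : (x : G) ∈ K := hΩ x x.2 (by rw [← Subgroup.coe_pow, hxp, Subgroup.coe_one])
    exact Subtype.ext (hKcentral x h1 t t.2)
  have hgen : Subgroup.closure {t : L | (orderOf t).Coprime p} = ⊤ := by
    have hle : L ≤ (Subgroup.closure {t : L | (orderOf t).Coprime p}).map L.subtype := by
      rw [MonoidHom.map_closure]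
      refine hWL.ge.trans (Subgroup.closure_mono ?_)
      rintro t ⟨ht, hto⟩
      exact ⟨⟨t, ht⟩, by rwa [Set.mem_ofPred_eq, Subgroup.orderOf_mk], rfl⟩
    rw [eq_top_iff]
    intro l _
    obtain ⟨y, hy, hyl⟩ := hle l.2
    exact (Subtype.ext hyl : y = l) ▸ hy
  obtain ⟨S⟩ : Nonempty (Sylow p L) := inferInstance
  have hS := hloc.sylow_eq_bot hgen S
  have hLbot : L = ⊥ := by
    refine hO L hKL.normal_top ?_
    have h1 := S.not_dvd_index
    rw [hS, Subgroup.index_bot] at h1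
    exact ((Nat.Prime.coprime_iff_not_dvd hp).mpr h1).symm
  exact hL (hLbot ▸ IsPGroup.of_bot)

/-! ### Sections that are `p`-groups -/

theorem commute_mk_iff {K : Subgroup G} [K.Normal] {u l : G} :
    (u : G ⧸ K) * l = l * u ↔ u * l * u⁻¹ * l⁻¹ ∈ K := by
  rw [← QuotientGroup.eq_one_iff, QuotientGroup.mk_mul, QuotientGroup.mk_mul,
    QuotientGroup.mk_mul, QuotientGroup.mk_inv, QuotientGroup.mk_inv, mul_inv_eq_one,
    mul_inv_eq_iff_eq_mul]

/-- If `P` centralizes `L / K`, then so does its normal closure. -/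
theorem commutator_mem_of_mem_normalClosure {P K L : Subgroup G} [K.Normal] [L.Normal]
    (h : ∀ u ∈ P, ∀ l ∈ L, u * l * u⁻¹ * l⁻¹ ∈ K) :
    ∀ u ∈ Subgroup.normalClosure (P : Set G), ∀ l ∈ L, u * l * u⁻¹ * l⁻¹ ∈ K := by
  have hn : (L.map (QuotientGroup.mk' K)).Normal :=
    Subgroup.Normal.map inferInstance _ (QuotientGroup.mk'_surjective K)
  have hle : Subgroup.normalClosure (P : Set G) ≤ (Subgroup.centralizer
      (L.map (QuotientGroup.mk' K) : Set (G ⧸ K))).comap (QuotientGroup.mk' K) := by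
    refine Subgroup.normalClosure_le_normal fun u hu => ?_
    rw [SetLike.mem_coe, Subgroup.mem_comap, Subgroup.mem_centralizer_iff]
    rintro _ ⟨l, hl, rfl⟩
    exact (commute_mk_iff.mpr (h u hu l hl)).symm
  intro u hu l hl
  have h1 := Subgroup.mem_centralizer_iff.mp (hle hu) _ ⟨l, hl, rfl⟩
  exact commute_mk_iff.mp h1.symm

/-- If `P` centralizes `L / K`, then every `p'`-element of the normal closure of `P` that
centralizes `K` also centralizes `L`. -/
theorem IsCentralizedPGroup.of_commutator_mem [Fact p.Prime] {P K L : Subgroup G} [K.Normal]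
    [L.Normal] (hK : IsCentralizedPGroup p P K) (hL : IsPGroup p L)
    (h : ∀ u ∈ P, ∀ l ∈ L, u * l * u⁻¹ * l⁻¹ ∈ K) : IsCentralizedPGroup p P L :=
  ⟨hL, fun t ht hto l hl => commute_of_commutator_mem hK.1 hto (hK.2 t ht hto)
    (commutator_mem_of_mem_normalClosure h t ht l hl)⟩

/-- A nontrivial subgroup of `P` normalized by `P` has an element of order `p` centralized
by `P`. -/
theorem IsPGroup.exists_pow_eq_one [Finite G] [Fact p.Prime] {P B : Subgroup G}
    (hP : IsPGroup p P) (hne : B ≠ ⊥) (hBP : B ≤ P) (hB : P ≤ Subgroup.normalizer (B : Set G)) :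
    ∃ z ∈ B, z ≠ 1 ∧ z ^ p = 1 ∧ ∀ u ∈ P, Commute u z := by
  have hp : p.Prime := Fact.out
  obtain ⟨b, hbB, hb1, hb⟩ := hP.exists_commutator_mem (A := ⊥) (bot_lt_iff_ne_bot.mpr hne) hBP
    Subgroup.le_normalizer_of_normal hB
  have hb1' : b ≠ 1 := fun h => hb1 (h ▸ one_mem _)
  obtain ⟨k, hk⟩ := (IsPGroup.iff_orderOf.mp hP) ⟨b, hBP hbB⟩
  rw [Subgroup.orderOf_mk] at hk
  have hcomm : ∀ u ∈ P, Commute u b := fun u hu => by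
    have h1 := Subgroup.mem_bot.mp (hb u hu)
    exact mul_inv_eq_iff_eq_mul.mp (mul_inv_eq_one.mp h1)
  rcases k with _ | k
  · exact absurd (orderOf_eq_one_iff.mp hk) hb1'
  refine ⟨b ^ p ^ k, pow_mem hbB _, fun h => ?_, ?_, fun u hu => (hcomm u hu).pow_right _⟩
  · have := orderOf_dvd_of_pow_eq_one h
    rw [hk, Nat.pow_dvd_pow_iff_le_right hp.one_lt] at this
    omega
  · rw [← pow_mul, ← pow_succ, ← hk, pow_orderOf_eq_one]

theorem zpowers_le_of_pow_eq_one [Fact p.Prime] {z w : G} (hz : z ^ p = 1) (hw : w ≠ 1)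
    (hwz : w ∈ Subgroup.zpowers z) : Subgroup.zpowers w = Subgroup.zpowers z := by
  have hz1 : z ≠ 1 := by
    rintro rfl
    rw [Subgroup.zpowers_one_eq_bot, Subgroup.mem_bot] at hwz
    exact hw hwz
  have hcard : Nat.card (Subgroup.zpowers z) = p := by
    rw [Nat.card_zpowers, orderOf_eq_prime hz hz1]
  refine le_antisymm (by rwa [Subgroup.zpowers_le]) ?_
  rw [Subgroup.zpowers_le]
  obtain ⟨n, hn⟩ := mem_zpowers_of_prime_card hcard (g := ⟨w, hwz⟩)
    (g' := ⟨z, Subgroup.mem_zpowers z⟩) (fun h => hw (congrArg Subtype.val h))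
  exact ⟨n, congrArg Subtype.val hn⟩

theorem card_zpowers_sup_zpowers [Fact p.Prime] {z x : G} (hzx : Commute z x) (hz : z ^ p = 1)
    (hz1 : z ≠ 1) (hx : x ^ p = 1) (hxz : x ∉ Subgroup.zpowers z) :
    Nat.card (Subgroup.zpowers z ⊔ Subgroup.zpowers x : Subgroup G) = p ^ 2 := by
  have hx1 : x ≠ 1 := fun h => hxz (h ▸ one_mem _)
  have hdisj : Disjoint (Subgroup.zpowers z) (Subgroup.zpowers x) := by
    rw [Subgroup.disjoint_def]
    intro w hwz hwx
    by_contra hw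
    have h1 := zpowers_le_of_pow_eq_one hx hw hwx
    exact hxz ((Subgroup.zpowers_le.mpr hwz) (h1.ge (Subgroup.mem_zpowers x)))
  have hcomm : ∀ (a : Subgroup.zpowers z) (b : Subgroup.zpowers x),
      Commute ((Subgroup.zpowers z).subtype a) ((Subgroup.zpowers x).subtype b) := by
    rintro ⟨_, m, rfl⟩ ⟨_, n, rfl⟩
    exact hzx.zpow_zpow m n
  have hinj : Function.Injective (MonoidHom.noncommCoprod _ _ hcomm) := by
    rw [MonoidHom.noncommCoprod_injective]
    refine ⟨Subgroup.subtype_injective _, Subgroup.subtype_injective _, ?_⟩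
    rwa [Subgroup.range_subtype, Subgroup.range_subtype]
  have hrange : (MonoidHom.noncommCoprod _ _ hcomm).range =
      Subgroup.zpowers z ⊔ Subgroup.zpowers x := by
    rw [MonoidHom.noncommCoprod_range, Subgroup.range_subtype, Subgroup.range_subtype]
  rw [← hrange, ← Nat.card_congr (MonoidHom.ofInjective hinj).toEquiv, Nat.card_prod,
    Nat.card_zpowers, Nat.card_zpowers, orderOf_eq_prime hz hz1, orderOf_eq_prime hx hx1, sq]

theorem HasPrimePowerIndexSections.normal_sup [Finite G] [Fact p.Prime] (P : Sylow p G)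
    {H K L : Subgroup G} (hH : HasPrimePowerIndexSections p H) (hHL : H ≤ L)
    (hKL : IsLargestNormalBelow K L)
    (hP : (P : Subgroup G) ≤ Subgroup.normalizer ((H ⊔ K : Subgroup G) : Set G)) :
    (H ⊔ K).Normal := by
  obtain ⟨B, hB, hBK, n, hn⟩ := hH K L hKL
  have := hKL.normal_top
  obtain ⟨m, hm⟩ := Subgroup.index_normalizer_inf L hn
  rw [inf_eq_left.mpr (hHL.trans le_sup_left), Subgroup.sup_inf_eq_of_le B hHL, hBK] at hm
  exact P.normal_of_le_normalizer hP hm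

/-- The case of a nontrivial `K`. If `L` is a `p`-group not centralized by the `p'`-elements of the
normal closure of `P`, then `L = [L, C(K)]` has exponent dividing `p ^ 2` and `K` is central in `L`.
An element `x` of `L` outside `K` which is fixed by `P` modulo `K` lies in a subgroup `H` of order
`p ^ 2` with `H K = ⟨x⟩ K`, and the index condition gives `L = ⟨x⟩ K`. -/
theorem IsLargestNormalBelow.isCentralizedPGroup_of_ne_bot [Finite G] [Fact p.Prime]
    (P : Sylow p G)
    (hP : ∀ H ≤ (P : Subgroup G), Nat.card H = p ^ 2 → HasPrimePowerIndexSections p H)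
    {K L : Subgroup G} (hKL : IsLargestNormalBelow K L) (hL : IsPGroup p L)
    (hK : IsCentralizedPGroup p (P : Subgroup G) K) (hK0 : K ≠ ⊥) :
    IsCentralizedPGroup p (P : Subgroup G) L := by
  have hp : p.Prime := Fact.out
  have hLn := hKL.normal_top
  have hKn := hKL.normal_bot
  have hLP : L ≤ P := hL.le_sylow_of_normal P
  have hKP : K ≤ P := hKL.lt.le.trans hLP
  have hL0 : L ≠ ⊥ := (bot_le.trans_lt hKL.lt).ne'
  set R := Subgroup.centralizer (K : Set G)
  have hLR : ⁅L, R⁆ ≤ L := Subgroup.commutator_le_left L R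
  rcases hLR.lt_or_eq with hlt | heq
  · have hle := hKL.le_of_lt _ inferInstance hlt
    refine ⟨hL, fun t ht hto l hl => ?_⟩
    have htR : t ∈ R := by
      rw [Subgroup.mem_centralizer_iff]
      exact fun k hk => (hK.2 t ht hto k hk).symm.eq
    refine commute_of_commutator_mem hK.1 hto (hK.2 t ht hto) ?_
    have := inv_mem (hle (Subgroup.commutator_mem_commutator hl htR))
    rwa [commutatorElement_inv] at this
  have hKR : ∀ k ∈ K, ∀ r ∈ R, Commute k r := fun k hk r hr =>
    Subgroup.mem_centralizer_iff.mp hr k hk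
  have hKL' := commute_of_commutator_eq heq (Subgroup.commutator_le_left K L) hKR
  have hΦ : pFrattini p L ≤ K := hKL.le_of_lt _ (pFrattini_normal L) (pFrattini_lt hL hL0)
  have hexp := pow_sq_eq_one_of_commutator_eq heq hΦ hKR hKL'
  obtain ⟨x, hxL, hxK, hx⟩ := P.2.exists_commutator_mem hKL.lt hLP
    Subgroup.le_normalizer_of_normal Subgroup.le_normalizer_of_normal
  obtain ⟨z, hzK, hz1, hzp, hz⟩ := P.2.exists_pow_eq_one hK0 hKP Subgroup.le_normalizer_of_normal
  obtain ⟨H, hHL, hHc, hHK⟩ : ∃ H ≤ L, Nat.card H = p ^ 2 ∧ H ⊔ K = Subgroup.zpowers x ⊔ K := by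
    by_cases hxp : x ^ p = 1
    · refine ⟨Subgroup.zpowers z ⊔ Subgroup.zpowers x, ?_, ?_, ?_⟩
      · rw [sup_le_iff, Subgroup.zpowers_le, Subgroup.zpowers_le]
        exact ⟨hKL.lt.le hzK, hxL⟩
      · refine card_zpowers_sup_zpowers (hz x (hLP hxL)).symm hzp hz1 hxp fun h => hxK ?_
        exact (Subgroup.zpowers_le.mpr hzK) h
      · rw [sup_comm (Subgroup.zpowers z), sup_assoc,
          sup_eq_right.mpr (Subgroup.zpowers_le.mpr hzK)]
    · refine ⟨Subgroup.zpowers x, Subgroup.zpowers_le.mpr hxL, ?_, rfl⟩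
      rw [Nat.card_zpowers]
      exact orderOf_eq_prime_pow (n := 1) (by rwa [pow_one]) (hexp x hxL)
  -- The elements fixed by `P` modulo `K`.
  set F := (Subgroup.centralizer ((P : Subgroup G).map (QuotientGroup.mk' K) :
    Set (G ⧸ K))).comap (QuotientGroup.mk' K)
  have hxF : Subgroup.zpowers x ⊔ K ≤ F := by
    refine sup_le ?_ fun k hk => ?_
    · rw [Subgroup.zpowers_le, Subgroup.mem_comap, Subgroup.mem_centralizer_iff]
      rintro _ ⟨u, hu, rfl⟩
      exact commute_mk_iff.mpr (hx u hu)
    · rw [Subgroup.mem_comap, QuotientGroup.mk'_apply, (QuotientGroup.eq_one_iff k).mpr hk]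
      exact one_mem _
  have hF : ∀ f ∈ F, ∀ u ∈ P, u * f * u⁻¹ * f⁻¹ ∈ K := fun f hf u hu =>
    commute_mk_iff.mp (Subgroup.mem_centralizer_iff.mp hf _ ⟨u, hu, rfl⟩)
  have hPn : (P : Subgroup G) ≤ Subgroup.normalizer ((H ⊔ K : Subgroup G) : Set G) := by
    refine Subgroup.le_normalizer_iff.mpr fun u hu h hh => ?_
    have h2 := hF h (hxF (hHK ▸ hh)) u hu
    have h3 := mul_mem (Subgroup.mem_sup_right (S := H) h2) hh
    rwa [inv_mul_cancel_right] at h3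
  have hn := (hP H (hHL.trans hLP) hHc).normal_sup P hHL hKL hPn
  have hle : H ⊔ K ≤ L := sup_le hHL hKL.lt.le
  have heqL : H ⊔ K = L := by
    refine hle.lt_or_eq.resolve_left fun hlt => hxK ?_
    refine hKL.le_of_lt _ hn hlt ?_
    rw [hHK]
    exact Subgroup.mem_sup_left (Subgroup.mem_zpowers x)
  refine hK.of_commutator_mem hL fun u hu l hl => hF l (hxF ?_) u hu
  rwa [← hHK, heqL]

/-! ### Minimal normal `p`-subgroups -/

theorem Subgroup.eq_of_card_eq_sq [Finite G] [Fact p.Prime] {A S T : Subgroup G}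
    (hA : Nat.card A = p) (hT : Nat.card T = p ^ 2) (hAS : A ≤ S) (hST : S < T) : S = A := by
  have hp : p.Prime := Fact.out
  obtain ⟨j, hj, hjS⟩ := (Nat.dvd_prime_pow hp).mp (hT ▸ Subgroup.card_dvd_of_le hST.le)
  have hj1 : j ≤ 1 := by
    by_contra hlt
    have hj2 : j = 2 := by omega
    exact hST.ne (Subgroup.eq_of_le_of_card_ge hST.le (by rw [hT, hjS, hj2]))
  refine (Subgroup.eq_of_le_of_card_ge hAS ?_).symm
  rw [hjS, hA]
  calc p ^ j ≤ p ^ 1 := Nat.pow_le_pow_right hp.pos hj1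
    _ = p := pow_one p

theorem isCentralizedPGroup_bot (P : Subgroup G) : IsCentralizedPGroup p P ⊥ :=
  ⟨IsPGroup.of_bot, fun t _ _ m hm => by rw [Subgroup.mem_bot.mp hm]; exact Commute.one_right t⟩

theorem Subgroup.index_normalizer_map_conj (A : Subgroup G) (v : G) :
    (Subgroup.normalizer ((A.map (MulAut.conj v).toMonoidHom : Subgroup G) : Set G)).index =
      (Subgroup.normalizer (A : Set G)).index := by
  rw [← Subgroup.map_equiv_normalizer_eq]
  exact Subgroup.index_map_equiv _ (MulAut.conj v)

theorem conj_pow_of_commute {u a c : G} (h : u * a * u⁻¹ = c * a) (hc : Commute u c) (m : ℕ) :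
    u ^ m * a * (u ^ m)⁻¹ = c ^ m * a := by
  induction m with
  | zero => simp
  | succ m ih =>
    calc u ^ (m + 1) * a * (u ^ (m + 1))⁻¹ = u * (u ^ m * a * (u ^ m)⁻¹) * u⁻¹ := by
          rw [pow_succ']; simp only [mul_assoc, mul_inv_rev]
      _ = (u * c ^ m) * a * u⁻¹ := by rw [ih]; simp only [mul_assoc]
      _ = c ^ m * (u * a * u⁻¹) := by rw [(hc.pow_right m).eq]; simp only [mul_assoc]
      _ = c ^ (m + 1) * a := by rw [h, pow_succ, mul_assoc]

/-- If `P` centralizes the subgroup `Z` of the abelian group `L` and fixes `y` modulo `Z`, then it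
fixes every element of `Z ⟨y⟩` modulo `Z`. -/
theorem commutator_mem_of_mem_sup_zpowers {P L Z : Subgroup G} {y : G}
    (hab : ∀ a ∈ L, ∀ b ∈ L, Commute a b) (hZL : Z ≤ L) (hyL : y ∈ L)
    (hZ : ∀ u ∈ P, ∀ w ∈ Z, Commute u w) (hy : ∀ u ∈ P, u * y * u⁻¹ * y⁻¹ ∈ Z) :
    ∀ u ∈ P, ∀ l ∈ Z ⊔ Subgroup.zpowers y, u * l * u⁻¹ * l⁻¹ ∈ Z := by
  intro u hu
  let F : Subgroup G :=
    { carrier := {l | l ∈ L ∧ u * l * u⁻¹ * l⁻¹ ∈ Z}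
      one_mem' := ⟨one_mem L, by simp⟩
      mul_mem' := by
        rintro a b ⟨ha, ha'⟩ ⟨hb, hb'⟩
        refine ⟨mul_mem ha hb, ?_⟩
        have h1 : u * (a * b) * u⁻¹ * (a * b)⁻¹ =
            (u * a * u⁻¹ * a⁻¹) * (a * (u * b * u⁻¹ * b⁻¹) * a⁻¹) := by group
        rw [h1, (hab a ha _ (hZL hb')).eq, mul_inv_cancel_right]
        exact mul_mem ha' hb'
      inv_mem' := by
        rintro a ⟨ha, ha'⟩
        refine ⟨inv_mem ha, ?_⟩
        have h1 : u * a⁻¹ * u⁻¹ * a⁻¹⁻¹ = a⁻¹ * (u * a * u⁻¹ * a⁻¹)⁻¹ * a := by group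
        rw [h1, (hab _ (inv_mem ha) _ (hZL (inv_mem ha'))).eq, inv_mul_cancel_right]
        exact inv_mem ha' }
  have hF : Z ⊔ Subgroup.zpowers y ≤ F := by
    refine sup_le (fun w hw => ⟨hZL hw, ?_⟩) (Subgroup.zpowers_le.mpr ⟨hyL, hy u hu⟩)
    rw [(hZ u hu w hw).eq, mul_inv_cancel_right, mul_inv_cancel]
    exact one_mem Z
  exact fun l hl => (hF hl).2

/-- The case of a minimal normal `p`-subgroup `L`. If `P` does not centralize `L`, then
`|L| = p ^ 2` and there is a subgroup `⟨z⟩` of order `p` of `L` centralized by `P`. The index condition forces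
every `H` of order `p ^ 2` containing `z` to be `L`, and no normal subgroup of order divisible by
`p` meets `L` trivially. So `L` contains all elements of order `p` of `P`, and some `x` in `P` has
order `p ^ 2`, with `a = x ^ p` in `L` but not in `⟨z⟩`. The index condition for `⟨x⟩` shows that
the normalizer of `⟨a⟩` has `p`-power index. But `⟨a⟩` is conjugate to `⟨z⟩`, since `P` permutes
the subgroups of order `p` of `L` other than `⟨z⟩` transitively. So `⟨z⟩` is normal, a
contradiction. -/
theorem IsLargestNormalBelow.isCentralizedPGroup_of_bot [Finite G] [Fact p.Prime]
    (P : Sylow p G)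
    (hP : ∀ H ≤ (P : Subgroup G), Nat.card H = p ^ 2 → HasPrimePowerIndexSections p H)
    {L : Subgroup G} (hKL : IsLargestNormalBelow ⊥ L) (hL : IsPGroup p L) :
    IsCentralizedPGroup p (P : Subgroup G) L := by
  have hp : p.Prime := Fact.out
  have hLn := hKL.normal_top
  have hLP : L ≤ P := hL.le_sylow_of_normal P
  have hL0 : L ≠ ⊥ := hKL.lt.ne'
  by_contra hcon
  have hnc : ¬ ∀ u ∈ P, ∀ l ∈ L, Commute u l := fun h =>
    hcon ((isCentralizedPGroup_bot _).of_commutator_mem hL fun u hu l hl => by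
      rw [(h u hu l hl).eq, mul_inv_cancel_right, mul_inv_cancel]
      exact one_mem _)
  have hΦ : pFrattini p L = ⊥ :=
    le_bot_iff.mp (hKL.le_of_lt _ (pFrattini_normal L) (pFrattini_lt hL hL0))
  have hexp : ∀ l ∈ L, l ^ p = 1 := fun l hl => by
    rw [← Subgroup.mem_bot, ← hΦ]; exact pow_mem_pFrattini hl
  have hab : ∀ a ∈ L, ∀ b ∈ L, Commute a b := fun a ha b hb => by
    rw [← commutatorElement_eq_one_iff_commute, ← Subgroup.mem_bot, ← hΦ]
    exact commutator_mem_pFrattini ha hb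
  obtain ⟨z, hzL, hz1, hzp, hz⟩ :=
    P.2.exists_pow_eq_one hL0 hLP Subgroup.le_normalizer_of_normal
  set Z := Subgroup.zpowers z with hZdef
  have hzZ : z ∈ Z := Subgroup.mem_zpowers z
  have hZL : Z ≤ L := Subgroup.zpowers_le.mpr hzL
  have hZcard : Nat.card Z = p := by rw [hZdef, Nat.card_zpowers, orderOf_eq_prime hzp hz1]
  have hZcomm : ∀ u ∈ P, ∀ w ∈ Z, Commute u w := by
    rintro u hu _ ⟨n, rfl⟩
    exact (hz u hu).zpow_right n
  have hZlt : Z < L := lt_of_le_of_ne hZL fun h => hnc (h ▸ hZcomm)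
  have hZn : ¬ Z.Normal := fun h => hz1 (Subgroup.mem_bot.mp (hKL.le_of_lt Z h hZlt hzZ))
  have hPZ : (P : Subgroup G) ≤ Subgroup.normalizer (Z : Set G) :=
    Subgroup.le_normalizer_iff.mpr fun u hu w hw => by
      rw [(hZcomm u hu w hw).eq, mul_inv_cancel_right]; exact hw
  -- `L` has order `p ^ 2`, and `P` centralizes `L / Z`.
  obtain ⟨y, hyL, hyZ, hy⟩ := P.2.exists_commutator_mem hZlt hLP hPZ
    Subgroup.le_normalizer_of_normal
  have hfix' := commutator_mem_of_mem_sup_zpowers hab hZL hyL hZcomm hy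
  have hLy : Z ⊔ Subgroup.zpowers y ≤ L := sup_le hZL (Subgroup.zpowers_le.mpr hyL)
  have hcard' : Nat.card (Z ⊔ Subgroup.zpowers y : Subgroup G) = p ^ 2 :=
    card_zpowers_sup_zpowers (hab z hzL y hyL) hzp hz1 (hexp y hyL) hyZ
  have hLeq : Z ⊔ Subgroup.zpowers y = L := by
    have hn := (hP _ (hLy.trans hLP) hcard').normal_sup P hLy hKL (by
      rw [sup_bot_eq]
      refine Subgroup.le_normalizer_iff.mpr fun u hu l hl => ?_
      have h1 := mul_mem (Subgroup.mem_sup_left (hfix' u hu l hl)) hl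
      rwa [inv_mul_cancel_right] at h1)
    rw [sup_bot_eq] at hn
    refine hLy.lt_or_eq.resolve_left fun hlt => hz1 (Subgroup.mem_bot.mp ?_)
    exact hKL.le_of_lt _ hn hlt (Subgroup.mem_sup_left hzZ)
  rw [hLeq] at hfix' hcard'
  have hfix : ∀ u ∈ P, ∀ l ∈ L, u * l * u⁻¹ * l⁻¹ ∈ Z := hfix'
  have hLcard : Nat.card L = p ^ 2 := hcard'
  have hsec : ∀ H ≤ (P : Subgroup G), Nat.card H = p ^ 2 → ∃ B : Subgroup G, B.Normal ∧
      L ⊓ B = ⊥ ∧ ∃ n, (Subgroup.normalizer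
        (((H ⊓ (L ⊔ B) ⊔ B) ⊓ L : Subgroup G) : Set G)).index = p ^ n := by
    intro H hHP hHc
    obtain ⟨B, hB, hBL, n, hn⟩ := hP H hHP hHc ⊥ L hKL
    exact ⟨B, hB, hBL, Subgroup.index_normalizer_inf L hn⟩
  have hkey : ∀ H ≤ (P : Subgroup G), Nat.card H = p ^ 2 → z ∈ H →
      ∃ B : Subgroup G, B.Normal ∧ L ⊓ B = ⊥ ∧ L ≤ H ⊔ B := by
    intro H hHP hHc hzH
    obtain ⟨B, hB, hBL, n, hn⟩ := hsec H hHP hHc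
    refine ⟨B, hB, hBL, ?_⟩
    have hZX : Z ≤ (H ⊓ (L ⊔ B) ⊔ B) ⊓ L := by
      rw [hZdef, Subgroup.zpowers_le]
      exact ⟨Subgroup.mem_sup_left ⟨hzH, Subgroup.mem_sup_left hzL⟩, hzL⟩
    rcases (inf_le_right : (H ⊓ (L ⊔ B) ⊔ B) ⊓ L ≤ L).lt_or_eq with hlt | heq
    · rw [Subgroup.eq_of_card_eq_sq hZcard hLcard hZX hlt] at hn
      exact absurd (P.normal_of_le_normalizer hPZ hn) hZn
    · exact (heq.ge.trans inf_le_left).trans (sup_le_sup_right inf_le_left B)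
  have hcenter : ∀ w ∈ P, (∀ u ∈ P, Commute u w) → w ^ p = 1 → w ∈ Z := by
    intro w hwP hw hwp
    by_contra hwZ
    obtain ⟨B, hB, hBL, hLB⟩ := hkey (Z ⊔ Subgroup.zpowers w)
      (sup_le (hZL.trans hLP) (Subgroup.zpowers_le.mpr hwP))
      (card_zpowers_sup_zpowers (hw z (hLP hzL)) hzp hz1 hwp hwZ) (Subgroup.mem_sup_left hzZ)
    refine hnc fun u hu l hl => ?_
    obtain ⟨h, hh, b, hb, rfl⟩ := Subgroup.mem_sup_of_normal_right.mp (hLB hl)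
    have huh : u * h = h * u := by
      have hle : Z ⊔ Subgroup.zpowers w ≤ Subgroup.centralizer {u} := by
        rw [sup_le_iff, hZdef, Subgroup.zpowers_le, Subgroup.zpowers_le,
          Subgroup.mem_centralizer_singleton_iff, Subgroup.mem_centralizer_singleton_iff]
        exact ⟨(hz u hu).symm.eq, (hw u hu).symm.eq⟩
      exact (Subgroup.mem_centralizer_singleton_iff.mp (hle hh)).symm
    have h1 : u * (h * b) * u⁻¹ * (h * b)⁻¹ ∈ L ⊓ B := by
      refine ⟨L.mul_mem (hLn.conj_mem _ hl u) (L.inv_mem hl), ?_⟩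
      have h2 : u * (h * b) * u⁻¹ * (h * b)⁻¹ = h * (u * b * u⁻¹ * b⁻¹) * h⁻¹ := by
        rw [← mul_assoc u, huh]; group
      rw [h2]
      exact hB.conj_mem _ (mul_mem (hB.conj_mem b hb u) (inv_mem hb)) h
    rw [hBL, Subgroup.mem_bot, mul_inv_eq_one, mul_inv_eq_iff_eq_mul] at h1
    exact h1
  have hPB : ∀ B : Subgroup G, B.Normal → L ⊓ B = ⊥ → (P : Subgroup G) ⊓ B = ⊥ := by
    intro B hB hBL
    by_contra hne
    obtain ⟨w, hwB, hw1, hwp, hw⟩ := P.2.exists_pow_eq_one hne inf_le_left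
      ((le_inf Subgroup.le_normalizer Subgroup.le_normalizer_of_normal).trans
        Subgroup.inf_normalizer_le_normalizer_inf)
    have hwL : w ∈ L ⊓ B := ⟨hZL (hcenter w hwB.1 hw hwp), hwB.2⟩
    rw [hBL] at hwL
    exact hw1 (Subgroup.mem_bot.mp hwL)
  -- If `h ∈ P` and `h b ∈ L` with `b ∈ B`, then `b = 1`.
  have hPBmem : ∀ B : Subgroup G, B.Normal → L ⊓ B = ⊥ → ∀ H ≤ (P : Subgroup G),
      ∀ l ∈ L, l ∈ H ⊔ B → l ∈ H := by
    intro B hB hBL H hHP l hl hlB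
    obtain ⟨h, hh, b, hb, rfl⟩ := Subgroup.mem_sup_of_normal_right.mp hlB
    have h1 : b ∈ (P : Subgroup G) ⊓ B := by
      refine ⟨?_, hb⟩
      have := mul_mem (inv_mem (hHP hh)) (hLP hl)
      rwa [inv_mul_cancel_left] at this
    rw [hPB B hB hBL, Subgroup.mem_bot] at h1
    rwa [h1, mul_one]
  have hHL : ∀ H ≤ (P : Subgroup G), Nat.card H = p ^ 2 → z ∈ H → H = L := by
    intro H hHP hHc hzH
    obtain ⟨B, hB, hBL, hLB⟩ := hkey H hHP hHc hzH
    refine (Subgroup.eq_of_le_of_card_ge (fun l hl => ?_) (by rw [hLcard, hHc])).symm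
    exact hPBmem B hB hBL H hHP l hl (hLB hl)
  have hΩ : ∀ x ∈ P, x ^ p = 1 → x ∈ L := by
    intro x hx hxp
    by_cases hxZ : x ∈ Z
    · exact hZL hxZ
    rw [← hHL (Z ⊔ Subgroup.zpowers x) (sup_le (hZL.trans hLP) (Subgroup.zpowers_le.mpr hx))
      (card_zpowers_sup_zpowers (hz x hx).symm hzp hz1 hxp hxZ) (Subgroup.mem_sup_left hzZ)]
    exact Subgroup.mem_sup_right (Subgroup.mem_zpowers x)
  obtain ⟨x, hxP, hxp, hxp2⟩ : ∃ x ∈ P, x ^ p ≠ 1 ∧ x ^ p ^ 2 = 1 := by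
    by_contra! hno
    refine hnc fun u hu l hl => hab u (hΩ u hu ?_) l hl
    by_contra hup
    obtain ⟨k, hk⟩ := (IsPGroup.iff_orderOf.mp P.2) ⟨u, hu⟩
    rw [Subgroup.orderOf_mk] at hk
    obtain ⟨j, rfl⟩ : ∃ j, k = j + 2 := by
      refine ⟨k - 2, ?_⟩
      by_contra hk2
      refine hup (orderOf_dvd_iff_pow_eq_one.mp ?_)
      rw [hk]
      exact (pow_dvd_pow p (show k ≤ 1 by omega)).trans (pow_one p).dvd
    refine hno (u ^ p ^ j) (pow_mem hu _) (fun h => ?_) ?_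
    · rw [← pow_mul, ← pow_succ] at h
      have h1 := orderOf_dvd_of_pow_eq_one h
      rw [hk, Nat.pow_dvd_pow_iff_le_right hp.one_lt] at h1
      omega
    · rw [← pow_mul, ← pow_add, ← hk, pow_orderOf_eq_one]
  have hxcard : Nat.card (Subgroup.zpowers x) = p ^ 2 := by
    rw [Nat.card_zpowers]
    exact orderOf_eq_prime_pow (n := 1) (by rwa [pow_one]) hxp2
  have hxHP : Subgroup.zpowers x ≤ (P : Subgroup G) := Subgroup.zpowers_le.mpr hxP
  have hxL : x ∉ L := fun h => hxp (hexp x h)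
  set a := x ^ p with ha
  have hax : a ∈ Subgroup.zpowers x := pow_mem (Subgroup.mem_zpowers x) p
  have hap : a ^ p = 1 := by rw [ha, ← pow_mul, ← sq, hxp2]
  have haL : a ∈ L := hΩ a (pow_mem hxP p) hap
  have haZ : a ∉ Z := fun h => by
    have h1 := zpowers_le_of_pow_eq_one hzp hxp h
    have h2 : z ∈ Subgroup.zpowers x :=
      (Subgroup.zpowers_le.mpr hax) (h1.ge (Subgroup.mem_zpowers z))
    exact hxL (hHL _ hxHP hxcard h2 ▸ Subgroup.mem_zpowers x)
  obtain ⟨n, hn⟩ : ∃ n, (Subgroup.normalizer (Subgroup.zpowers a : Set G)).index = p ^ n := by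
    obtain ⟨B, hB, hBL, n, hn⟩ := hsec _ hxHP hxcard
    refine ⟨n, ?_⟩
    suffices h : (Subgroup.zpowers x ⊓ (L ⊔ B) ⊔ B) ⊓ L = Subgroup.zpowers a by rwa [h] at hn
    have hle : (Subgroup.zpowers x ⊓ (L ⊔ B) ⊔ B) ⊓ L ≤ Subgroup.zpowers x ⊓ L := fun l hl =>
      ⟨hPBmem B hB hBL _ hxHP l hl.2 (sup_le_sup_right inf_le_left B hl.1), hl.2⟩
    refine Subgroup.eq_of_card_eq_sq (by rw [Nat.card_zpowers, orderOf_eq_prime hap hxp]) hxcard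
      ?_ ?_
    · rw [Subgroup.zpowers_le]
      exact ⟨Subgroup.mem_sup_left ⟨hax, Subgroup.mem_sup_left haL⟩, haL⟩
    · refine lt_of_le_of_lt hle (lt_of_le_of_ne inf_le_left fun h => hxL ?_)
      exact (h.ge (Subgroup.mem_zpowers x)).2
  -- `⟨a⟩` is conjugate to `⟨z⟩`: some conjugate `b` of `z` lies outside `⟨z⟩`, and `⟨b⟩` contains
  -- an element of the coset of `a` modulo `⟨z⟩`, all of whose elements are conjugate under `P`.
  obtain ⟨u, hu, hua⟩ : ∃ u ∈ P, ¬ Commute u a := by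
    by_contra! h
    exact haZ (hcenter a (hLP haL) h hap)
  set c := u * a * u⁻¹ * a⁻¹ with hc
  have hcZ : c ∈ Z := hfix u hu a haL
  have hc1 : c ≠ 1 := fun h => hua (mul_inv_eq_iff_eq_mul.mp (mul_inv_eq_one.mp h))
  obtain ⟨g, hg⟩ : ∃ g, g * z * g⁻¹ ∉ Z := by
    by_contra! h
    refine hZn ⟨?_⟩
    rintro _ ⟨m, rfl⟩ g
    have h1 := zpow_mem (h g) m
    rwa [conj_zpow] at h1
  set b := g * z * g⁻¹ with hb
  have hbL : b ∈ L := hLn.conj_mem z hzL g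
  have hbZ : Subgroup.zpowers b ⊔ Z = L := by
    rw [sup_comm]
    refine Subgroup.eq_of_le_of_card_ge (sup_le hZL (Subgroup.zpowers_le.mpr hbL)) ?_
    rw [hLcard, card_zpowers_sup_zpowers (hab z hzL b hbL) hzp hz1 (hexp b hbL) hg]
  obtain ⟨b', hb', w, hw, hbw⟩ : ∃ b' ∈ Subgroup.zpowers b, ∃ w ∈ Z, b' * w = a := by
    have h1 : a ∈ ((Subgroup.zpowers b ⊔ Z : Subgroup G) : Set G) := hbZ.ge haL
    rw [Subgroup.coe_mul_of_left_le_normalizer_right] at h1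
    · exact h1
    · rw [Subgroup.zpowers_le]
      exact hPZ (hLP hbL)
  have hwc : w⁻¹ ∈ Subgroup.zpowers c := (zpowers_le_of_pow_eq_one hzp hc1 hcZ).ge (inv_mem hw)
  obtain ⟨m, hm⟩ := mem_powers_iff_mem_zpowers.mpr hwc
  have hconj : u ^ m * a * (u ^ m)⁻¹ = b' := by
    have hcm : c ^ m = w⁻¹ := hm
    rw [conj_pow_of_commute (c := c) (by rw [hc, inv_mul_cancel_right]) (hZcomm u hu c hcZ), hcm,
      ← hbw, ((hab w (hZL hw) b' ((Subgroup.zpowers_le.mpr hbL) hb')).inv_left.mul_right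
        ((Commute.refl w).inv_left)).eq, mul_inv_cancel_right]
  have hb'1 : b' ≠ 1 := fun h => hxp (by
    rw [h] at hconj
    rw [mul_inv_eq_one] at hconj
    exact mul_eq_left.mp hconj)
  have hbb' := zpowers_le_of_pow_eq_one (hexp b hbL) hb'1 hb'
  have hZa : Z = (Subgroup.zpowers a).map (MulAut.conj (g⁻¹ * u ^ m)).toMonoidHom := by
    have h1 : (MulAut.conj g⁻¹).toMonoidHom b = z := by
      simp only [MulEquiv.toMonoidHom_eq_coe, MonoidHom.coe_coe, MulAut.conj_apply, hb]; group
    have h2 : (MulAut.conj (g⁻¹ * u ^ m)).toMonoidHom a = (MulAut.conj g⁻¹).toMonoidHom b' := by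
      simp only [MulEquiv.toMonoidHom_eq_coe, MonoidHom.coe_coe, MulAut.conj_apply, ← hconj]; group
    rw [MonoidHom.map_zpowers, h2, ← MonoidHom.map_zpowers, hbb', MonoidHom.map_zpowers, h1]
  rw [← Subgroup.index_normalizer_map_conj _ (g⁻¹ * u ^ m), ← hZa] at hn
  exact hZn (P.normal_of_le_normalizer hPZ hn)

/-! ### Normality of the Sylow subgroup when `O_{p'}(G) = 1` -/

theorem IsCentralizedPGroup.sup {P M₁ M₂ : Subgroup G} [M₁.Normal]
    (h₁ : IsCentralizedPGroup p P M₁) (h₂ : IsCentralizedPGroup p P M₂) :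
    IsCentralizedPGroup p P (M₁ ⊔ M₂) := by
  refine ⟨h₁.1.to_sup_of_normal_left h₂.1, fun t ht hto m hm => ?_⟩
  have hle : M₁ ⊔ M₂ ≤ Subgroup.centralizer {t} := by
    refine sup_le (fun m hm => ?_) (fun m hm => ?_) <;>
      rw [Subgroup.mem_centralizer_singleton_iff]
    · exact (h₁.2 t ht hto m hm).symm.eq
    · exact (h₂.2 t ht hto m hm).symm.eq
  exact (Subgroup.mem_centralizer_singleton_iff.mp (hle hm)).symm

/-- If `O_{p'}(G) = 1`, then the index condition for the subgroups of order `p ^ 2` of `P` forces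
`P` to be normal. Otherwise a minimal normal subgroup `L` that is not a centralized `p`-group has a
largest normal subgroup `K` below it, and each possibility for `L / K` has been excluded. -/
theorem Sylow.normal_of_hasPrimePowerIndexSections [Finite G] [Fact p.Prime] (P : Sylow p G)
    (hcard : p ^ 2 ≤ Nat.card P)
    (hP : ∀ H ≤ (P : Subgroup G), Nat.card H = p ^ 2 → HasPrimePowerIndexSections p H)
    (hO : ∀ N : Subgroup G, N.Normal → (Nat.card N).Coprime p → N = ⊥) :
    (P : Subgroup G).Normal := by
  set Y := Subgroup.normalClosure (P : Set G) with hYdef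
  by_cases hY : IsCentralizedPGroup p (P : Subgroup G) Y
  · have h1 : Y = P := P.is_maximal' hY.1 Subgroup.le_normalClosure
    rw [← h1]
    exact Subgroup.normalClosure_normal
  exfalso
  obtain ⟨L, ⟨hLn, hLY, hL⟩, hmin⟩ := (Set.toFinite {M : Subgroup G | M.Normal ∧ M ≤ Y ∧
    ¬ IsCentralizedPGroup p (P : Subgroup G) M}).exists_minimal
      ⟨Y, Subgroup.normalClosure_normal, le_rfl, hY⟩
  have hgood : ∀ M : Subgroup G, M.Normal → M < L → IsCentralizedPGroup p (P : Subgroup G) M := by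
    intro M hM hlt
    by_contra h
    exact hlt.not_ge (hmin ⟨hM, hlt.le.trans hLY, h⟩ hlt.le)
  have hL0 : ⊥ < L := by
    rw [bot_lt_iff_ne_bot]
    rintro rfl
    exact hL (isCentralizedPGroup_bot _)
  obtain ⟨K, ⟨hKn, hKL⟩, hmax⟩ := (Set.toFinite {M : Subgroup G | M.Normal ∧ M < L}).exists_maximal
    ⟨⊥, inferInstance, hL0⟩
  have hsec : IsLargestNormalBelow K L := by
    refine ⟨hKn, hLn, hKL, fun M hM hlt => ?_⟩
    have hn : (K ⊔ M).Normal := inferInstance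
    have hlt' : K ⊔ M < L := by
      refine lt_of_le_of_ne (sup_le hKL.le hlt.le) fun h => hL ?_
      rw [← h]
      exact (hgood K hKn hKL).sup (hgood M hM hlt)
    exact le_sup_right.trans (hmax ⟨hn, hlt'⟩ le_sup_left)
  have hK := hgood K hKn hKL
  have hLp : IsPGroup p L := hsec.isPGroup P hcard hP hO hLY hK
  rcases eq_or_ne K ⊥ with rfl | hK0
  · exact hL (hsec.isCentralizedPGroup_of_bot P hP hLp)
  · exact hL (hsec.isCentralizedPGroup_of_ne_bot P hP hLp hK hK0)

/-! ### From the partial `Π`-property to the index condition modulo a normal `p'`-subgroup -/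

/-- For a `p`-group `H`, the condition at `L / K` says that the normalizer of `(H ∩ L) K` has
`p`-power index, also when `H ∩ L ≤ K`. -/
theorem PiConditionAt.index_eq_pow [Finite G] [Fact p.Prime] {H K L : Subgroup G} [K.Normal]
    (h : PiConditionAt H K L) (hH : IsPGroup p H) (hKL : K ≤ L) :
    ∃ n, (Subgroup.normalizer ((H ⊓ L ⊔ K : Subgroup G) : Set G)).index = p ^ n := by
  have hcomap : (H.imageMod K ⊓ L.imageMod K).comap (QuotientGroup.mk' K) = H ⊓ L ⊔ K := by
    rw [Subgroup.comap_inf, Subgroup.imageMod, Subgroup.imageMod, QuotientGroup.comap_map_mk',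
      QuotientGroup.comap_map_mk', sup_eq_right.mpr hKL]
    apply le_antisymm
    · rintro x ⟨hx, hxL⟩
      obtain ⟨k, hk, y, hy, rfl⟩ := Subgroup.mem_sup_of_normal_left.mp hx
      have hyL : y ∈ L := by
        have := L.mul_mem (L.inv_mem (hKL hk)) hxL
        rwa [inv_mul_cancel_left] at this
      exact mul_mem (Subgroup.mem_sup_right hk) (Subgroup.mem_sup_left ⟨hy, hyL⟩)
    · exact sup_le (le_inf (inf_le_left.trans le_sup_right) inf_le_right) (le_inf le_sup_left hKL)
  have hidx : (Subgroup.normalizer ((H ⊓ L ⊔ K : Subgroup G) : Set G)).index =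
      (Subgroup.normalizer
        ((H.imageMod K ⊓ L.imageMod K : Subgroup (G ⧸ K)) : Set (G ⧸ K))).index := by
    rw [← hcomap, ← Subgroup.comap_normalizer_eq_of_surjective _ (QuotientGroup.mk'_surjective K),
      Subgroup.index_comap_of_surjective _ (QuotientGroup.mk'_surjective K)]
  have hpg : IsPGroup p (H.imageMod K ⊓ L.imageMod K : Subgroup (G ⧸ K)) :=
    (hH.map (QuotientGroup.mk' K)).to_inf_left
  refine ⟨_, Nat.eq_prime_pow_of_unique_prime_dvd Subgroup.index_ne_zero_of_finite
    fun {q} hq hqd => ?_⟩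
  rw [hidx] at hqd
  obtain ⟨-, hqc⟩ := h q hq hqd
  obtain ⟨n, hn⟩ := IsPGroup.iff_card.mp hpg
  rw [hn] at hqc
  exact (Nat.prime_dvd_prime_iff_eq hq Fact.out).mp (hq.dvd_of_dvd_pow hqc)

/-- In `G / N` the image of a chief factor of `G` is a chief factor or trivial. -/
theorem IsChiefFactor.map_mk' {K L : Subgroup G} (h : IsChiefFactor K L) {N : Subgroup G}
    [N.Normal] {M : Subgroup (G ⧸ N)} (hM : M.Normal) (hKM : K.map (QuotientGroup.mk' N) ≤ M)
    (hML : M ≤ L.map (QuotientGroup.mk' N)) :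
    M = K.map (QuotientGroup.mk' N) ∨ M = L.map (QuotientGroup.mk' N) := by
  have hLn := h.normal_top
  have hMeq : (M.comap (QuotientGroup.mk' N) ⊓ L).map (QuotientGroup.mk' N) = M := by
    apply le_antisymm
    · rintro _ ⟨x, hx, rfl⟩
      exact hx.1
    · intro x hx
      obtain ⟨y, hy, rfl⟩ := hML hx
      exact ⟨y, ⟨hx, hy⟩, rfl⟩
  rcases h.eq_or_eq (M.comap (QuotientGroup.mk' N) ⊓ L) inferInstance
    (le_inf (Subgroup.map_le_iff_le_comap.mp hKM) h.lt.le) inf_le_right with h1 | h1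
  · left; rw [← h1, hMeq]
  · right; rw [← h1, hMeq]

/-- Passing to the quotient by a normal `p'`-subgroup `N` does not change the intersection of a
`p`-subgroup with a normal subgroup. -/
theorem IsPGroup.map_mk'_inf [Finite G] [Fact p.Prime] {H : Subgroup G} (hH : IsPGroup p H)
    {N : Subgroup G} [N.Normal] (hN : (Nat.card N).Coprime p) (A : Subgroup G) [A.Normal] :
    H.map (QuotientGroup.mk' N) ⊓ A.map (QuotientGroup.mk' N) =
      (H ⊓ A).map (QuotientGroup.mk' N) := by
  refine le_antisymm ?_ (Subgroup.map_inf_le _ _ _)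
  rintro _ ⟨⟨h, hh, rfl⟩, ⟨a, ha, hah⟩⟩
  refine ⟨h, ⟨hh, ?_⟩, rfl⟩
  have hn : a⁻¹ * h ∈ N := QuotientGroup.eq.mp hah
  have hmk : (h : G ⧸ A) = ((a⁻¹ * h : G) : G ⧸ A) := by
    rw [QuotientGroup.mk_mul, (QuotientGroup.eq_one_iff (N := A) _).mpr (inv_mem ha), one_mul]
  have h1 : (h : G ⧸ A) ^ Nat.card N = 1 := by
    have h2 : (a⁻¹ * h) ^ Nat.card N = 1 :=
      congrArg Subtype.val (pow_card_eq_one' (G := N) (x := ⟨_, hn⟩))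
    rw [hmk, ← QuotientGroup.mk_pow, h2, QuotientGroup.mk_one]
  obtain ⟨k, hk⟩ := isPGroup_iff_pow_pow_eq_one.mp hH ⟨h, hh⟩
  have hk' : h ^ p ^ k = 1 := congrArg Subtype.val hk
  have h2 : (h : G ⧸ A) ^ p ^ k = 1 := by rw [← QuotientGroup.mk_pow, hk', QuotientGroup.mk_one]
  refine (QuotientGroup.eq_one_iff (N := A) h).mp (orderOf_eq_one_iff.mp ?_)
  exact Nat.eq_one_of_dvd_coprimes (hN.pow_right k) (orderOf_dvd_of_pow_eq_one h1)
    (orderOf_dvd_of_pow_eq_one h2)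

/-- The term `B` of the chief series is the last one whose image in `G / N` does not
contain `L`. -/
theorem PartialPiProperty.hasPrimePowerIndexSections [Finite G] [Fact p.Prime] {H : Subgroup G}
    (h : PartialPiProperty H) (hH : IsPGroup p H) {N : Subgroup G} [N.Normal]
    (hN : (Nat.card N).Coprime p) :
    HasPrimePowerIndexSections p (H.map (QuotientGroup.mk' N)) := by
  obtain ⟨Γ, hΓ⟩ := h
  intro K L hKL
  have hKn := hKL.normal_bot
  have hLn := hKL.normal_top
  set π := QuotientGroup.mk' N
  obtain ⟨i, hi0, hi1⟩ : ∃ i : Fin Γ.length, ¬ L ≤ (Γ.term i.castSucc).map π ∧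
      L ≤ (Γ.term i.succ).map π := by
    by_contra! hno
    have hall : ∀ i, ¬ L ≤ (Γ.term i).map π := by
      intro i
      induction i using Fin.induction with
      | zero =>
        rw [Γ.term_zero, Subgroup.map_bot]
        exact (bot_le.trans_lt hKL.lt).not_ge
      | succ i ih => exact hno i ih
    refine hall (Fin.last _) ?_
    rw [Γ.term_last, Subgroup.map_top_of_surjective _ (QuotientGroup.mk'_surjective N)]
    exact le_top
  have hchief := Γ.isChiefFactor i
  have hn0 := Γ.normal_term i.castSucc
  have hn1 := Γ.normal_term i.succ
  obtain ⟨n, hn⟩ := (hΓ i).index_eq_pow hH hchief.lt.le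
  set A₀ := Γ.term i.castSucc
  set A₁ := Γ.term i.succ
  have hA₀ : (A₀.map π).Normal := hn0.map π (QuotientGroup.mk'_surjective N)
  have hA : A₀.map π ≤ A₁.map π := Subgroup.map_mono hchief.lt.le
  have hLA : L ⊔ A₀.map π = A₁.map π := by
    refine (hchief.map_mk' (N := N) (M := L ⊔ A₀.map π) inferInstance le_sup_right
      (sup_le hi1 hA)).resolve_left fun h => hi0 ?_
    exact h ▸ le_sup_left
  refine ⟨A₀.map π, hA₀, le_antisymm ?_ ?_, ?_⟩
  · exact hKL.le_of_lt _ inferInstance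
      (lt_of_le_of_ne inf_le_left fun h => hi0 (inf_eq_left.mp h))
  · rcases hchief.map_mk' (N := N) (M := K ⊔ A₀.map π) inferInstance le_sup_right
      (sup_le (hKL.lt.le.trans hi1) hA) with h | h
    · exact le_inf hKL.lt.le (h ▸ le_sup_left)
    · exfalso
      have h1 : (K ⊔ A₀.map π) ⊓ L = L := inf_eq_right.mpr (h ▸ hi1)
      rw [Subgroup.sup_inf_eq_of_le _ hKL.lt.le] at h1
      have h2 : L ⊓ A₀.map π ≤ K := hKL.le_of_lt _ inferInstance
        (lt_of_le_of_ne inf_le_left fun h => hi0 (inf_eq_left.mp h))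
      exact hKL.lt.not_ge (h1 ▸ sup_le le_rfl h2)
  · rw [hLA, hH.map_mk'_inf hN A₁, ← Subgroup.map_sup]
    have h1 := (Subgroup.index_dvd_of_le (Subgroup.le_normalizer_map
      (H := (H ⊓ A₁ ⊔ A₀ : Subgroup G)) π)).trans
        (Subgroup.index_map_dvd _ (QuotientGroup.mk'_surjective N))
    rw [hn] at h1
    obtain ⟨m, -, hm⟩ := (Nat.dvd_prime_pow Fact.out).mp h1
    exact ⟨m, hm⟩

theorem card_map_mk'_of_coprime [Finite G] {H N : Subgroup G} [N.Normal]
    (h : (Nat.card N).Coprime (Nat.card H)) :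
    Nat.card (H.map (QuotientGroup.mk' N)) = Nat.card H := by
  rw [← Subgroup.relIndex_ker, QuotientGroup.ker_mk', ← Subgroup.inf_relIndex_right,
    (Subgroup.disjoint_of_coprime_natCard h).eq_bot, Subgroup.relIndex_bot_left]

/-- `G` has a normal `p'`-subgroup `N` with `N P` normal in `G`. -/
theorem exists_normal_coprime_sup_normal [Finite G] [Fact p.Prime] (P : Sylow p G)
    (hcard : p ^ 2 ≤ Nat.card P)
    (hP : ∀ H : Subgroup G, H ≤ (P : Subgroup G) → Nat.card H = p ^ 2 → PartialPiProperty H) :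
    ∃ N : Subgroup G, N.Normal ∧ (Nat.card N).Coprime p ∧ (N ⊔ P).Normal := by
  have hp : p.Prime := Fact.out
  obtain ⟨N, ⟨hNn, hN⟩, hmax⟩ := (Set.toFinite {M : Subgroup G | M.Normal ∧
    (Nat.card M).Coprime p}).exists_maximal ⟨⊥, inferInstance, by simp⟩
  refine ⟨N, hNn, hN, ?_⟩
  have hsurj := QuotientGroup.mk'_surjective N
  have hcop : ∀ H ≤ (P : Subgroup G), (Nat.card N).Coprime (Nat.card H) := by
    intro H hH
    obtain ⟨n, hn⟩ := IsPGroup.iff_card.mp (P.2.to_le hH)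
    rw [hn]
    exact hN.pow_right n
  have hPn : ((P.mapSurjective hsurj : Sylow p (G ⧸ N)) : Subgroup (G ⧸ N)).Normal := by
    refine Sylow.normal_of_hasPrimePowerIndexSections _ ?_ ?_ ?_
    · rw [Sylow.coe_mapSurjective, card_map_mk'_of_coprime (hcop _ le_rfl)]
      exact hcard
    · intro H hHP hHc
      rw [Sylow.coe_mapSurjective] at hHP
      set H' := H.comap (QuotientGroup.mk' N) ⊓ P
      have hH' : H'.map (QuotientGroup.mk' N) = H := by
        apply le_antisymm
        · rintro _ ⟨x, hx, rfl⟩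
          exact hx.1
        · intro x hx
          obtain ⟨y, hy, rfl⟩ := hHP hx
          exact ⟨y, ⟨hx, hy⟩, rfl⟩
      have hH'P : H' ≤ P := inf_le_right
      have hc : Nat.card H' = p ^ 2 := by
        rw [← card_map_mk'_of_coprime (hcop H' hH'P), hH', hHc]
      rw [← hH']
      exact (hP H' hH'P hc).hasPrimePowerIndexSections (P.2.to_le hH'P) hN
    · intro M hM hMc
      have h1 : (Nat.card (M.comap (QuotientGroup.mk' N))).Coprime p := by
        have h2 := (M.comap (QuotientGroup.mk' N)).card_mul_index
        rw [Subgroup.index_comap_of_surjective _ hsurj, ← N.card_mul_index,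
          Subgroup.index_eq_card N, ← M.card_mul_index, ← mul_assoc] at h2
        rw [Nat.eq_of_mul_eq_mul_right
          (Nat.pos_of_ne_zero Subgroup.index_ne_zero_of_finite) h2]
        exact Nat.Coprime.mul_left hN hMc
      have h2 := hmax (y := M.comap (QuotientGroup.mk' N)) ⟨inferInstance, h1⟩
        (QuotientGroup.le_comap_mk' N M)
      rw [eq_bot_iff]
      intro x hx
      obtain ⟨y, rfl⟩ := hsurj x
      exact (QuotientGroup.eq_one_iff y).mpr (h2 hx)
  rw [Sylow.coe_mapSurjective] at hPn
  rw [← QuotientGroup.comap_map_mk' N (P : Subgroup G)]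
  exact hPn.comap _

/-! ### `p`-solubility and the upper `p`-series -/

theorem le_pPrimeRadicalOver (R : {N : Subgroup G // N.Normal}) {M : Subgroup G} (hM : M.Normal)
    (h : haveI := R.2; (Nat.card (M.map (QuotientGroup.mk' R.1))).Coprime p) :
    M ≤ (pPrimeRadicalOver p R).1 := by
  have := R.2
  have hn : (M.map (QuotientGroup.mk' R.1)).Normal :=
    hM.map _ (QuotientGroup.mk'_surjective R.1)
  exact Subgroup.map_le_iff_le_comap.mp (le_sSup ⟨hn, h⟩)

theorem le_pRadicalOver (R : {N : Subgroup G // N.Normal}) {M : Subgroup G} (hM : M.Normal)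
    (h : haveI := R.2; IsPGroup p (M.map (QuotientGroup.mk' R.1))) :
    M ≤ (pRadicalOver p R).1 := by
  have := R.2
  have hn : (M.map (QuotientGroup.mk' R.1)).Normal :=
    hM.map _ (QuotientGroup.mk'_surjective R.1)
  exact Subgroup.map_le_iff_le_comap.mp (le_sSup ⟨hn, h⟩)

theorem pLength_le_one_of_sup_normal [Finite G] [Fact p.Prime] (P : Sylow p G) {N : Subgroup G}
    (hNn : N.Normal) (hN : (Nat.card N).Coprime p) (hNP : (N ⊔ P).Normal) :
    pLength p G ≤ 1 := by
  have hp : p.Prime := Fact.out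
  have h0 : N ≤ (upperPSeries p G 0).1 :=
    le_pPrimeRadicalOver _ hNn (Nat.Coprime.coprime_dvd_left (Subgroup.card_map_dvd _ _) hN)
  have hR0 := (upperPSeries p G 0).2
  have h1 : N ⊔ P ≤ (pRadicalOver p (upperPSeries p G 0)).1 := by
    refine le_pRadicalOver _ hNP ?_
    rw [Subgroup.map_sup, (Subgroup.map_eq_bot_iff N).mpr (by rwa [QuotientGroup.ker_mk']),
      bot_sup_eq]
    exact P.2.map _
  have h2 : (upperPSeries p G 1).1 = ⊤ := by
    rw [eq_top_iff]
    have hR1 := (pRadicalOver p (upperPSeries p G 0)).2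
    refine le_pPrimeRadicalOver _ inferInstance ?_
    rw [Subgroup.map_top_of_surjective _ (QuotientGroup.mk'_surjective _), Subgroup.card_top,
      ← Subgroup.index_eq_card]
    refine Nat.Coprime.coprime_dvd_left (Subgroup.index_dvd_of_le (le_sup_right.trans h1)) ?_
    exact ((Nat.Prime.coprime_iff_not_dvd hp).mpr P.not_dvd_index).symm
  exact iInf₂_le_of_le 1 h2 le_rfl

theorem isPSoluble_of_sup_normal [Finite G] [Fact p.Prime] (P : Sylow p G) {N : Subgroup G}
    (hNn : N.Normal) (hN : (Nat.card N).Coprime p) (hNP : (N ⊔ P).Normal) :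
    IsPSoluble p G := by
  have hp : p.Prime := Fact.out
  intro K L hKn hKL
  have hLn := hKL.normal_top
  -- For `M` normal in `G`, either `M` covers `L / K` or `M ∩ L ≤ K`.
  have hcover : ∀ M : Subgroup G, M.Normal →
      L.imageMod K = (L ⊓ M).map (QuotientGroup.mk' K) ∨ L ⊓ M ≤ K := by
    intro M hM
    rcases hKL.eq_or_eq (L ⊓ M ⊔ K) inferInstance le_sup_right
      (sup_le inf_le_left hKL.lt.le) with h | h
    · exact Or.inr (h ▸ le_sup_left)
    · left
      conv_lhs => rw [← h]
      rw [Subgroup.imageMod, Subgroup.map_sup, QuotientGroup.map_mk'_self, sup_bot_eq]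
  rcases hcover N hNn with h | hLN
  · right
    rw [h]
    exact Nat.Coprime.coprime_dvd_left ((Subgroup.card_map_dvd _ _).trans
      (Subgroup.card_dvd_of_le inf_le_right)) hN
  rcases hcover (N ⊔ P) hNP with h | hLP
  · left
    rw [h, isPGroup_iff_pow_pow_eq_one]
    rintro ⟨_, x, hx, rfl⟩
    have hpg : IsPGroup p ((N ⊔ P).map (QuotientGroup.mk' N)) := by
      rw [Subgroup.map_sup, QuotientGroup.map_mk'_self, bot_sup_eq]
      exact P.2.map _
    obtain ⟨k, hk⟩ := isPGroup_iff_pow_pow_eq_one.mp hpg ⟨_, ⟨x, hx.2, rfl⟩⟩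
    have hk' : ((x ^ p ^ k : G) : G ⧸ N) = 1 := congrArg Subtype.val hk
    refine ⟨k, Subtype.ext ?_⟩
    change ((x ^ p ^ k : G) : G ⧸ K) = 1
    rw [QuotientGroup.eq_one_iff] at hk' ⊢
    exact hLN ⟨pow_mem hx.1 _, hk'⟩
  · right
    refine ((Nat.Prime.coprime_iff_not_dvd hp).mpr fun hdvd => ?_).symm
    obtain ⟨y, hyo⟩ := exists_prime_orderOf_dvd_card' p hdvd
    obtain ⟨x, hx, hxy⟩ := y.2
    have h1 : x ^ (N ⊔ P : Subgroup G).index ∈ K :=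
      hLP ⟨pow_mem hx _, Subgroup.pow_index_mem _ x⟩
    have h2 : y ^ (N ⊔ P : Subgroup G).index = 1 := by
      refine Subtype.ext ?_
      rw [Subgroup.coe_pow, ← hxy]
      exact (QuotientGroup.eq_one_iff _).mpr h1
    have h3 : p ∣ (N ⊔ P : Subgroup G).index :=
      hyo.symm.dvd.trans (orderOf_dvd_of_pow_eq_one h2)
    exact P.not_dvd_index (h3.trans (Subgroup.index_dvd_of_le le_sup_right))

end

theorem theorem1p3 {G : Type*} [Group G] [Finite G] (p : ℕ) [Fact p.Prime] (P : Sylow p G)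
    (hP : p ^ 2 ≤ Nat.card ↥P)
    (hPi : ∀ H : Subgroup G, H ≤ (P : Subgroup G) → Nat.card ↥H = p ^ 2 → PartialPiProperty H) :
    IsPSoluble p G ∧ pLength p G ≤ 1 := by
  obtain ⟨N, hNn, hN, hNP⟩ := exists_normal_coprime_sup_normal P hP hPi
  exact ⟨isPSoluble_of_sup_normal P hNn hN hNP, pLength_le_one_of_sup_normal P hNn hN hNP⟩
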